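/- **Setting.** Scientists $1,\dots,N$ have scientific capital $h_1>h_2>\dots>h_N>0$. A problem consists of stages $1,\dots,M$; stage $m$ has value $V_m>0$, difficulty $d_m>0$ and fixed cost $F_m>0$, and stage $m+1$ can be attacked only by someone who has the solution of stage $m$. The opportunity cost per unit of capital and unit of time is $x\ge 0$, and $V_m-d_mx-F_m>0$ for every $m$. Time is continuous. At any time a scientist may start working on her first unsolved stage $m$ (paying $F_m$ each time she starts), abandon the stage she is working on, or publish any solutions she has. While scientist $i$ works on stage $m$ she pays $h_ix$ per unit of time and solves the stage at rate $h_i/d_m$ (independent exponential times). Published solutions become known to everybody at once, and whoever was working on a published stage stops working on it; all other actions, and unpublished solutions, are observed only by the scientist concerned. $V_m$ is credited to the first scientist who publishes the solution of stage $m$ (in equal shares if several publish it simultaneously). Payoffs are expected total credit minus expected total cost, without discounting. A strategy prescribes, measurably in a scientist's private record of what she has done and observed, the delay after which she will act next and the action. A perfect Bayesian equilibrium is a strategy profile for which there are beliefs (for each scientist and each of her information sets, a probability distribution on the histories in that set) such that (a) beliefs obey Bayes' rule along all play in which the other scientists follow their strategies, starting from the beginning of the game or from any information set, and (b) at every information set,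 on or off the equilibrium path, no scientist can increase her expected continuation payoff by changing her own strategy. A public sharing equilibrium (PSE) is a perfect Bayesian equilibrium in which every solution is published without delay and no stage is ever abandoned by a scientist working on it. For a stage $m$, a set $S$ of scientists and $i\in S$ let $$U^m_i(S)=V_m\frac{h_i}{\sum_{j\in S}h_j}-h_i\,x\,\frac{d_m}{\sum_{j\in S}h_j}-F_m .$$ Call $S$ an equilibrium of stage $m$ if $U^m_i(S)\ge 0$ for all $i\in S$ and $U^m_j(S\cup\{j\})\le 0$ for all $j\notin S$; call an equilibrium $S$ risk dominant if for every equilibrium $T$ of stage $m$ $$\Bigl|\sum_{i\in S\setminus T}U^m_i(S)\cdot\sum_{j\in T\setminus S}U^m_j(S\cup T)\Bigr|\ \ge\ \Bigl|\sum_{j\in T\setminus S}U^m_j(T)\cdot\sum_{i\in S\setminus T}U^m_i(S\cup T)\Bigr| .$$ Let $I^*_m=\{1,\dots,i^*_m\}$ with $i^*_m=\max\{i: U^m_i(\{1,\dots,i\})\ge 0\}$, and $h_{I^*_m-i}=\sum_{j\in I^*_m,\,j\ne i}h_j$. **Proposition 4.** Suppose that for every pair of stages $m<m'$ and every scientist $i$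 $$\frac{V_m\,h_{I^*_m-i}}{d_m}-\frac{h_i}{d_{m'}}\cdot\frac{V_{m'}\,h_{I^*_{m'}-i}+x\,d_{m'}h_i}{h_i+h_{I^*_{m'}-i}}\ \ge\ 0 .$$ Let $\sigma^*$ be the strategy profile in which every scientist $i$ publishes every solution without delay, starts working on stage $m$ as soon as stage $m-1$ has been published (for $m=1$: at time $0$) if $i\in I^*_m$ and not at all if $i\notin I^*_m$, and never abandons a stage. Then $\sigma^*$ is a public sharing equilibrium, and for every stage $m$ the set $I^*_m$ of participants is a risk dominant equilibrium of stage $m$. -/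

import Mathlib

open scoped ENNReal NNReal

/-- The primitives of a treasure hunt with `N` scientists and `M` stages. The stages are
`0, 1, …, M - 1`, attacked in this order (the values of `V`, `d`, `F` beyond `M - 1` play no
role). Scientist `i` has scientific capital `h i`; stage `m` has value `V m`, difficulty `d m` and
fixed cost `F m`; `x` is the opportunity cost per unit of capital and unit of time. -/
structure TreasureHunt (N : ℕ) where
  M : ℕ
  V : ℕ → ℝ
  d : ℕ → ℝ
  F : ℕ → ℝ
  h : Fin N → ℝ
  x : ℝ

namespace TreasureHunt

variable {N : ℕ}

/-! ### The one-stage participation game -/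

section Participation

variable (G : TreasureHunt N)

/-- Total capital of a group of scientists. -/
noncomputable def capital (S : Finset (Fin N)) : ℝ := ∑ j ∈ S, G.h j

/-- Expected payoff `U_i` of a member `i` of the group `S` racing for stage `m`. -/
noncomputable def stagePayoff (m : ℕ) (S : Finset (Fin N)) (i : Fin N) : ℝ :=
  G.V m * (G.h i / G.capital S) - G.h i * G.x * (G.d m / G.capital S) - G.F m

/-- `S` is an equilibrium set of participants for stage `m`. -/
def IsStageEquilibrium (m : ℕ) (S : Finset (Fin N)) : Prop :=
  (∀ i ∈ S, 0 ≤ G.stagePayoff m S i) ∧ ∀ j ∉ S, G.stagePayoff m (insert j S) j ≤ 0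

/-- `S` is a risk dominant equilibrium of the participation game of stage `m`. -/
def IsRiskDominant (m : ℕ) (S : Finset (Fin N)) : Prop :=
  G.IsStageEquilibrium m S ∧ ∀ T, G.IsStageEquilibrium m T →
    |(∑ j ∈ T \ S, G.stagePayoff m T j) * ∑ i ∈ S \ T, G.stagePayoff m (S ∪ T) i| ≤
      |(∑ i ∈ S \ T, G.stagePayoff m S i) * ∑ j ∈ T \ S, G.stagePayoff m (S ∪ T) j|

open Classical in
/-- The scientists `i` for whom racing for stage `m` against all scientists of smaller index
(`{1, …, i}` in one-based notation) is worthwhile. -/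
noncomputable def worthwhile (m : ℕ) : Finset (Fin N) :=
  Finset.univ.filter fun i => 0 ≤ G.stagePayoff m (Finset.Iic i) i

/-- The group `I*_m = {1, …, i*_m}`, where `i*_m` is the largest worthwhile index. -/
noncomputable def Istar (m : ℕ) : Finset (Fin N) :=
  if hne : (G.worthwhile m).Nonempty then Finset.Iic ((G.worthwhile m).max' hne) else ∅

/-- `h_{I*_m - i}`: total capital of the competitors of `i` in `I*_m`. -/
noncomputable def rivals (m : ℕ) (i : Fin N) : ℝ := G.capital ((G.Istar m).erase i)

end Participation

/-! ### Histories, information and strategies of the multi-stage game -/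

/-- What a scientist can do: start working on her first unsolved stage (paying its fixed cost),
abandon the stage she is working on, or publish her solutions of all stages `< r` (as far as she
has them). An action that is not applicable has no effect. -/
inductive Action where
  | enter
  | quit
  | publish (r : ℕ)

/-- One entry of the private record of a scientist: the date, whether she has just solved a stage,
the action that she has just taken (if any), and what is published at this moment: `pubs j = r > 0`
means that `j` publishes solutions of all stages `< r`, and `pubs j = 0` that `j` publishes nothing
new. -/
structure Entry (N : ℕ) where
  time : ℝ≥0
  solved : Bool
  act : Option Action
  pubs : Fin N → ℕ

/-- What a scientist knows: the number `pub` of published stages, the number `know ≥ pub` of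
stages whose solution she has, whether she is working on the next one (which is stage `know`), the
date of the last entry in her record, and the whole record, latest entry first. -/
structure Info (N : ℕ) where
  pub : ℕ
  know : ℕ
  work : Bool
  last : ℝ≥0
  record : List (Entry N)

/-- A node of the game tree: the date, the number of published stages, and the information of
every scientist (so that the node determines the complete past). -/
structure Node (N : ℕ) where
  time : ℝ≥0
  pub : ℕ
  info : Fin N → Info N

instance : MeasurableSpace Action := ⊤

instance : MeasurableSpace (Entry N) :=
  MeasurableSpace.comap Entry.time inferInstance ⊔ MeasurableSpace.comap Entry.solved ⊤ ⊔
    MeasurableSpace.comap Entry.act ⊤ ⊔ MeasurableSpace.comap Entry.pubs ⊤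

instance : MeasurableSpace (Info N) :=
  MeasurableSpace.comap Info.pub ⊤ ⊔ MeasurableSpace.comap Info.know ⊤ ⊔
    MeasurableSpace.comap Info.work ⊤ ⊔ MeasurableSpace.comap Info.last inferInstance ⊔
    MeasurableSpace.comap (fun I => List.equivSigmaTuple I.record) inferInstance

instance : MeasurableSpace (Node N) :=
  MeasurableSpace.comap Node.time inferInstance ⊔ MeasurableSpace.comap Node.pub ⊤ ⊔
    MeasurableSpace.comap Node.info inferInstance

/-- A strategy: after every entry in her record the scientist fixes a delay and an action, to be
taken after that delay unless a new entry in her record comes first. The delay `⊤` means that she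
only waits; the action is then irrelevant. -/
abbrev Strategy (N : ℕ) := Info N → ℝ≥0∞ × Action

/-- Start of the game. -/
def Node.initial : Node N where
  time := 0
  pub := 0
  info := fun _ => { pub := 0, know := 0, work := false, last := 0, record := [] }

/-- Time passes and nothing happens. -/
def Node.advance (s : Node N) (u : ℝ≥0) : Node N := { s with time := s.time + u }

/-- Scientist `j` solves the stage that she is working on. Nobody else notices. -/
def Node.solve (s : Node N) (j : Fin N) : Node N :=
  { s with
    info := Function.update s.info j
      { pub := (s.info j).pub
        know := (s.info j).know + 1
        work := false
        last := s.time
        record := ⟨s.time, true, none, fun _ => 0⟩ :: (s.info j).record } }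

/-- The level up to which `j` publishes new results under the action profile `a`, `0` if she does
not publish anything new. -/
def Node.level (s : Node N) (a : Fin N → Option Action) (j : Fin N) : ℕ :=
  match a j with
  | some (Action.publish r) =>
      if s.pub < min r (s.info j).know then min r (s.info j).know else 0
  | _ => 0

/-- The number of published stages after the action profile `a`. -/
def Node.nextPub (s : Node N) (a : Fin N → Option Action) : ℕ :=
  max s.pub (Finset.univ.sup (s.level a))

variable (G : TreasureHunt N)

/-- Does `j` work, after her own action, on the stage that she was facing? -/
def nextWork (s : Node N) (a : Fin N → Option Action) (j : Fin N) : Bool :=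
  match a j with
  | some Action.enter => decide ((s.info j).know < G.M)
  | some Action.quit => false
  | _ => (s.info j).work

/-- The scientists `j` with `a j ≠ none` act simultaneously. Publications are seen by everybody,
everything else only by the actor. Whoever was working on a stage that is now published has the
solution and stops working on it. -/
def act (s : Node N) (a : Fin N → Option Action) : Node N where
  time := s.time
  pub := s.nextPub a
  info := fun j =>
    if (a j).isNone ∧ s.nextPub a = s.pub then s.info j
    else
      { pub := s.nextPub a
        know := max (s.info j).know (s.nextPub a)
        work := decide (s.nextPub a ≤ (s.info j).know) && G.nextWork s a j
        last := s.time
        record := ⟨s.time, false, a j, s.level a⟩ :: (s.info j).record }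

/-- The nodes of the game tree. -/
inductive Reachable : Node N → Prop
  | initial : Reachable Node.initial
  | advance (s : Node N) (u : ℝ≥0) : Reachable s → Reachable (s.advance u)
  | solve (s : Node N) (j : Fin N) : Reachable s → (s.info j).work = true → Reachable (s.solve j)
  | act (s : Node N) (a : Fin N → Option Action) : Reachable s → Reachable (G.act s a)

/-- The information set of `i` at date `t` when her information is `I`. -/
def InfoSet (i : Fin N) (I : Info N) (t : ℝ≥0) : Set (Node N) :=
  {s | G.Reachable s ∧ s.time = t ∧ s.info i = I}

/-! ### Payoffs -/

/-- Value credited to `i` when the action profile `a` is played: every newly published stage is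
credited to its publisher (in equal shares if several publish it at the same instant). -/
noncomputable def credit (s : Node N) (a : Fin N → Option Action) (i : Fin N) : ℝ :=
  ∑ m ∈ Finset.Ico s.pub (s.level a i),
    G.V m / ((Finset.univ.filter fun j => m < s.level a j).card : ℝ)

/-- Fixed cost paid by `i` when the action profile `a` is played. -/
noncomputable def entryCost (s : Node N) (a : Fin N → Option Action) (i : Fin N) : ℝ :=
  if (s.info i).work = false ∧ G.nextWork s a i = true then G.F (s.info i).know else 0

/-- Hazard rate at which `j` solves the stage she is working on. -/
noncomputable def rate (s : Node N) (j : Fin N) : ℝ :=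
  if (s.info j).work = true then G.h j / G.d (s.info j).know else 0

/-- Total hazard rate. -/
noncomputable def totalRate (s : Node N) : ℝ := ∑ j, G.rate s j

/-- Date at which a scientist with information `I` plans to act. -/
noncomputable def alarm (τ : Strategy N) (I : Info N) : ℝ≥0∞ := I.last + (τ I).1

/-- Time that passes until the next planned action, provided nobody solves a stage before. -/
noncomputable def gap (σ : Fin N → Strategy N) (s : Node N) : ℝ≥0∞ :=
  (⨅ j, alarm (σ j) (s.info j)) - s.time

open Classical in
/-- The actions that are due at the node `s`. -/
noncomputable def due (σ : Fin N → Strategy N) (s : Node N) (j : Fin N) : Option Action :=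
  if alarm (σ j) (s.info j) ≤ s.time then some ((σ j) (s.info j)).2 else none

/-- The node at which the next planned actions are taken, just before they are taken. -/
noncomputable def actNode (σ : Fin N → Strategy N) (s : Node N) : Node N :=
  s.advance (gap σ s).toNNReal

/-- Probability that no stage is solved during a period of length `u`. -/
noncomputable def silence (s : Node N) (u : ℝ) : ℝ := Real.exp (-(G.totalRate s * u))

open Classical in
/-- Expectation of `f` at the node that follows `s` under the profile `σ`. The next node arises by
the first of these events: some `j` solves a stage, a planned action is taken, or a time `c` has
passed. If none of them ever happens, the contribution is `0`. -/
noncomputable def next (σ : Fin N → Strategy N) (c : ℝ≥0∞) (f : Node N → ℝ≥0∞) (s : Node N) :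
    ℝ≥0∞ :=
  (∑ j, ∫⁻ u in {u : ℝ | 0 < u ∧ ENNReal.ofReal u < min (gap σ s) c},
      ENNReal.ofReal (G.rate s j * G.silence s u) * f ((s.advance u.toNNReal).solve j)) +
    if gap σ s < c then
      ENNReal.ofReal (G.silence s (gap σ s).toReal) *
        f (G.act (actNode σ s) (due σ (actNode σ s)))
    else if c < ⊤ then
      ENNReal.ofReal (G.silence s c.toReal) * f (s.advance c.toNNReal)
    else 0

open Classical in
/-- Probability that the next event after `s` is a planned action. -/
noncomputable def actProb (σ : Fin N → Strategy N) (s : Node N) : ℝ≥0∞ :=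
  if gap σ s < ⊤ then ENNReal.ofReal (G.silence s (gap σ s).toReal) else 0

/-- Expected value credited to `i` after the node `s`, counting the first `n` events only. -/
noncomputable def rewardUpTo (σ : Fin N → Strategy N) (i : Fin N) : ℕ → Node N → ℝ≥0∞
  | 0, _ => 0
  | n + 1, s =>
      actProb G σ s * ENNReal.ofReal (G.credit (actNode σ s) (due σ (actNode σ s)) i) +
        G.next σ ⊤ (rewardUpTo σ i n) s

/-- Expected time until the next event. -/
noncomputable def expectedTime (σ : Fin N → Strategy N) (s : Node N) : ℝ≥0∞ :=
  ∫⁻ u in {u : ℝ | 0 < u ∧ ENNReal.ofReal u < gap σ s}, ENNReal.ofReal (G.silence s u)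

/-- Expected opportunity cost and fixed costs paid by `i` after the node `s`, counting the first
`n` events only. -/
noncomputable def costUpTo (σ : Fin N → Strategy N) (i : Fin N) : ℕ → Node N → ℝ≥0∞
  | 0, _ => 0
  | n + 1, s =>
      (if (s.info i).work = true then ENNReal.ofReal (G.h i * G.x) * G.expectedTime σ s else 0) +
        actProb G σ s * ENNReal.ofReal (G.entryCost (actNode σ s) (due σ (actNode σ s)) i) +
        G.next σ ⊤ (costUpTo σ i n) s

/-- Expected payoff of `i` from now on when the current node has distribution `ν` and the profile
`σ` is played. (The credited value is at most the sum of all `V m`; the cost may be infinite.) -/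
noncomputable def payoff (σ : Fin N → Strategy N) (i : Fin N)
    (ν : MeasureTheory.Measure (Node N)) : EReal :=
  ((∫⁻ s, ⨆ n, G.rewardUpTo σ i n s ∂ν : ℝ≥0∞) : EReal) -
    ((∫⁻ s, ⨆ n, G.costUpTo σ i n s ∂ν : ℝ≥0∞) : EReal)

/-! ### Perfect Bayesian equilibrium -/

open Classical in
/-- Follow the play under `σ` from the node `s` until the moment when the record of `i` has `n`
entries and a time `u` has passed since the last of them; `reachUpTo … f k s` is the expectation of
`f` at the node where this happens (`0` if it does not happen, or not within `k` events). -/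
noncomputable def reachUpTo (σ : Fin N → Strategy N) (i : Fin N) (n : ℕ) (u : ℝ≥0)
    (f : Node N → ℝ≥0∞) : ℕ → Node N → ℝ≥0∞
  | 0, _ => 0
  | k + 1, s =>
      if (s.info i).record.length = n then
        if s.time = (s.info i).last + u then f s
        else if s.time < (s.info i).last + u then
          G.next σ (((s.info i).last + u - s.time : ℝ≥0) : ℝ≥0∞) (reachUpTo σ i n u f k) s
        else 0
      else G.next σ ⊤ (reachUpTo σ i n u f k) s

/-- Expectation of `f` at the node where the record of `i` has `n` entries and a time `u` has
passed since the last of them, when play starts with the distribution `ν` and follows `σ`. -/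
noncomputable def reach (σ : Fin N → Strategy N) (i : Fin N) (n : ℕ) (u : ℝ≥0)
    (ν : MeasureTheory.Measure (Node N)) (f : Node N → ℝ≥0∞) : ℝ≥0∞ :=
  ∫⁻ s, ⨆ k, G.reachUpTo σ i n u f k s ∂ν

/-- A system of beliefs: for a scientist, her information and the date, a distribution over
nodes. -/
abbrev Beliefs (N : ℕ) := Fin N → Info N → ℝ≥0 → MeasureTheory.Measure (Node N)

/-- Bayes' rule for `i`, when play starts with the distribution `ν` and follows `σ`: at every later
moment the belief of `i` is the conditional distribution of the node given her information. -/
def BayesRule (σ : Fin N → Strategy N) (μ : Beliefs N) (i : Fin N)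
    (ν : MeasureTheory.Measure (Node N)) : Prop :=
  ∀ (n : ℕ) (u : ℝ≥0) (f : Node N → ℝ≥0∞) (φ : Info N → ℝ≥0∞), Measurable f → Measurable φ →
    G.reach σ i n u ν (fun s => φ (s.info i) * f s) =
      G.reach σ i n u ν (fun s => φ (s.info i) * ∫⁻ s', f s' ∂(μ i (s.info i) s.time))

/-- `σ` together with the beliefs `μ` is a perfect Bayesian equilibrium. -/
structure IsPerfectBayesianWith (σ : Fin N → Strategy N) (μ : Beliefs N) : Prop where
  measurable : ∀ i, Measurable (σ i)
  /-- At every information set the belief is a probability on that set. -/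
  isProbability : ∀ i I t, (G.InfoSet i I t).Nonempty → MeasureTheory.IsProbabilityMeasure (μ i I t)
  supported : ∀ i I t, (G.InfoSet i I t).Nonempty → ∀ᵐ s ∂(μ i I t), s ∈ G.InfoSet i I t
  /-- Beliefs obey Bayes' rule along all play in which the others follow `σ`, whatever the
  scientist does herself, from the start of the game … -/
  bayes_initial : ∀ i (τ : Strategy N), Measurable τ →
    G.BayesRule (Function.update σ i τ) μ i (MeasureTheory.Measure.dirac Node.initial)
  /-- … and from every information set, on or off the equilibrium path. -/
  bayes : ∀ i I t, (G.InfoSet i I t).Nonempty → ∀ τ : Strategy N, Measurable τ →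
    G.BayesRule (Function.update σ i τ) μ i (μ i I t)
  /-- At every information set, on or off the equilibrium path, no other strategy is better. -/
  rational : ∀ i I t, (G.InfoSet i I t).Nonempty → ∀ τ : Strategy N, Measurable τ →
    G.payoff (Function.update σ i τ) i (μ i I t) ≤ G.payoff σ i (μ i I t)

/-- `σ` is a perfect Bayesian equilibrium. -/
def IsPerfectBayesian (σ : Fin N → Strategy N) : Prop :=
  ∃ μ : Beliefs N, G.IsPerfectBayesianWith σ μ

/-- Public sharing strategy profile: every unpublished result is published without delay, and no
stage is abandoned. -/
def IsPublicSharing (σ : Fin N → Strategy N) : Prop :=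
  ∀ i I, (I.pub < I.know → (σ i I).1 = 0 ∧ ∃ r, I.know ≤ r ∧ (σ i I).2 = Action.publish r) ∧
    (I.work = true → (σ i I).2 = Action.quit → (σ i I).1 = ⊤)

/-- Public sharing equilibrium. -/
def IsPublicSharingEquilibrium (σ : Fin N → Strategy N) : Prop :=
  IsPublicSharing σ ∧ G.IsPerfectBayesian σ

open Classical in
/-- The profile `σ*`: publish every result without delay; enter the current stage `m` (without
delay) iff `i ∈ I*_m`; otherwise wait, and in particular never abandon a stage. -/
noncomputable def sigmaStar (i : Fin N) : Strategy N := fun I =>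
  if I.pub < I.know then (0, Action.publish I.know)
  else if I.work = false ∧ I.know < G.M ∧ i ∈ G.Istar I.know then (0, Action.enter)
  else (⊤, Action.enter)

end TreasureHunt

/-! Risk dominance is a computation within one stage. With A = V - d x, a member of a group S earns
A h_i / h(S) - F, so the two products to be compared depend only on the common capital C of S and T,
their exclusive capitals a, b and the numbers p, q of their exclusive members. The difference of the
products has the sign of (C + a)(A - pF) - (C + b)(A - qF) (`riskProduct_le`). For S = `Istar m`
this is nonnegative: S is an initial segment, so everybody in S \ T has more capital than everybody
in T \ S, and the equilibrium inequalities of the weakest member of S \ T and of the strongest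
member of T \ S suffice (`capital_mul_le_of_equilibria`).

In the dynamic game all beliefs are point masses. A rival who follows `sigmaStar` enters with delay
zero and publishes at the very date of discovery, so scientist i can compute the whole node from her
own record and the date; `replay` and `wait` do this. They also make sense of records that complying
rivals could not have caused: an unexpected publication is explained by rivals who enter and solve
at the moment of publishing, which the game tree permits because events may follow each other
without any delay. Hence the imagined node always lies in the information set, and in it the rivals
comply (`Reachable.explains`). Bayes' rule then says only that the actual node is the imagined one
whenever beliefs are evaluated (`reachUpTo_congr`). The exceptions, such as the instant between a
rival's discovery and its publication, are never evaluated.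

Sequential rationality therefore matters only at nodes with complying rivals, and there it is a
verification argument. The candidate value `contValue` adds the values of the unpublished solutions
of i and the positive parts of `workValue - F` over the later stages. No action raises it net of
credit and fixed cost. While time passes, work on the first unpublished stage is exactly fair
(`work_balance`). If i hides stage m and works on k > m, she risks V_m at the rivals' rate and gains
V_k - `workValue` at her own; the assumption on pairs of stages makes the risk prevail (`drift_le`).
Induction on the number of events bounds every strategy (`rewardUpTo_le`). Under `sigmaStar` the
steps are equalities, and finitely many events of bounded expected cost earn the value
(`exists_attains`). All bounds have the additive form reward ≤ cost + value, because the cost of a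
deviation may be infinite. -/

namespace TreasureHunt

variable {N : ℕ}

/-! ### The participation game of one stage -/

section StageGame

variable (G : TreasureHunt N)

/-- Value of a stage net of the opportunity cost of solving it. -/
noncomputable def netValue (m : ℕ) : ℝ := G.V m - G.d m * G.x

lemma stagePayoff_eq (m : ℕ) (S : Finset (Fin N)) (i : Fin N) :
    G.stagePayoff m S i = G.netValue m * G.h i / G.capital S - G.F m := by
  unfold stagePayoff netValue; ring

lemma stagePayoff_nonneg_iff {m : ℕ} {S : Finset (Fin N)} {i : Fin N} (hS : 0 < G.capital S) :
    0 ≤ G.stagePayoff m S i ↔ G.F m * G.capital S ≤ G.netValue m * G.h i := by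
  rw [stagePayoff_eq, sub_nonneg, le_div_iff₀ hS]

lemma stagePayoff_nonpos_iff {m : ℕ} {S : Finset (Fin N)} {i : Fin N} (hS : 0 < G.capital S) :
    G.stagePayoff m S i ≤ 0 ↔ G.netValue m * G.h i ≤ G.F m * G.capital S := by
  rw [stagePayoff_eq, sub_nonpos, div_le_iff₀ hS]

/-- Only the capital and the size of `P` matter; this reduces risk dominance to an inequality
between few real numbers. -/
lemma sum_stagePayoff (m : ℕ) (S P : Finset (Fin N)) :
    ∑ i ∈ P, G.stagePayoff m S i =
      G.netValue m * G.capital P / G.capital S - P.card * G.F m := by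
  simp only [stagePayoff_eq, Finset.sum_sub_distrib, Finset.sum_const, nsmul_eq_mul, capital,
    Finset.mul_sum, Finset.sum_div]

variable {G}

lemma capital_insert {S : Finset (Fin N)} {j : Fin N} (hj : j ∉ S) :
    G.capital (insert j S) = G.h j + G.capital S := Finset.sum_insert hj

lemma capital_nonneg (h_pos : ∀ i, 0 < G.h i) (S : Finset (Fin N)) : 0 ≤ G.capital S :=
  Finset.sum_nonneg fun i _ => (h_pos i).le

lemma capital_pos (h_pos : ∀ i, 0 < G.h i) {S : Finset (Fin N)} {i : Fin N} (hi : i ∈ S) :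
    0 < G.capital S := Finset.sum_pos (fun i _ => h_pos i) ⟨i, hi⟩

/-- Scientist `0` alone earns `netValue - F > 0`, so a largest worthwhile index exists. The argument
`j` only shows that there are scientists at all. -/
lemma Istar_eq_Iic (h_pos : ∀ i, 0 < G.h i) {m : ℕ} (hA : G.F m < G.netValue m) (j : Fin N) :
    ∃ k, G.Istar m = Finset.Iic k ∧ G.F m * G.capital (Finset.Iic k) ≤ G.netValue m * G.h k ∧
      ∀ l, k < l → G.netValue m * G.h l < G.F m * G.capital (Finset.Iic l) := by
  have hw : ∀ i, i ∈ G.worthwhile m ↔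
      G.F m * G.capital (Finset.Iic i) ≤ G.netValue m * G.h i := by
    intro i
    rw [worthwhile, Finset.mem_filter, and_iff_right (Finset.mem_univ i),
      stagePayoff_nonneg_iff _ (capital_pos h_pos (Finset.mem_Iic.2 le_rfl))]
  have hne : (G.worthwhile m).Nonempty := by
    have hN : 0 < N := lt_of_le_of_lt (Nat.zero_le _) j.2
    refine ⟨⟨0, hN⟩, (hw _).2 ?_⟩
    have h0 : Finset.Iic (⟨0, hN⟩ : Fin N) = {⟨0, hN⟩} := by
      ext a; simp only [Finset.mem_Iic, Finset.mem_singleton, Fin.le_def, Fin.ext_iff]; omega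
    rw [h0, capital, Finset.sum_singleton]
    exact mul_le_mul_of_nonneg_right hA.le (h_pos _).le
  refine ⟨(G.worthwhile m).max' hne, by rw [Istar, dif_pos hne], (hw _).1 (Finset.max'_mem _ _),
    fun l hl => ?_⟩
  by_contra hcon
  exact absurd (Finset.le_max' _ _ ((hw l).2 (not_lt.1 hcon))) (not_le.2 hl)

/-- The group `I*_m` is an equilibrium of the participation game. -/
lemma isStageEquilibrium_Istar (h_pos : ∀ i, 0 < G.h i) (h_anti : StrictAnti G.h) {m : ℕ}
    (hF : 0 < G.F m) (hA : G.F m < G.netValue m) : G.IsStageEquilibrium m (G.Istar m) := by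
  refine ⟨fun i hi => ?_, fun j hj => ?_⟩
  · obtain ⟨k, hk, hk1, -⟩ := Istar_eq_Iic h_pos hA i
    rw [stagePayoff_nonneg_iff _ (capital_pos h_pos hi), hk]
    rw [hk, Finset.mem_Iic] at hi
    exact hk1.trans (mul_le_mul_of_nonneg_left (h_anti.antitone hi) (hF.trans hA).le)
  · obtain ⟨k, hk, -, hk2⟩ := Istar_eq_Iic h_pos hA j
    rw [stagePayoff_nonpos_iff _ (capital_pos h_pos (Finset.mem_insert_self j _)),
      capital_insert hj, hk]
    rw [hk, Finset.mem_Iic, not_le] at hj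
    have hlt : (k : ℕ) < j := hj
    -- The first outsider is not worthwhile, and `j` has at most her capital. Staying out means
    -- `(netValue - F) * h ≤ F * capital (Iic k)`, which is inherited by smaller `h`.
    let l : Fin N := ⟨k + 1, by omega⟩
    have hIic : Finset.Iic l = insert l (Finset.Iic k) := by
      ext a; simp only [Finset.mem_Iic, Finset.mem_insert, Fin.le_def, Fin.ext_iff, l]; omega
    have hl : l ∉ Finset.Iic k := by simp [Fin.le_def, l]
    have h1 := hk2 l (by simp [Fin.lt_def, l])
    rw [hIic, capital_insert hl] at h1
    have h2 : G.h j ≤ G.h l := h_anti.antitone (by simp only [Fin.le_def, l]; omega)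
    nlinarith [mul_le_mul_of_nonneg_left h2 (sub_pos.2 hA).le]

lemma Istar_nonempty (h_pos : ∀ i, 0 < G.h i) {m : ℕ} (hA : G.F m < G.netValue m) (j : Fin N) :
    (G.Istar m).Nonempty := by
  obtain ⟨k, hk, -⟩ := Istar_eq_Iic h_pos hA j
  exact ⟨k, by simp [hk]⟩

lemma lt_of_mem_Istar (h_anti : StrictAnti G.h) {m : ℕ} {i j : Fin N} (hi : i ∈ G.Istar m)
    (hj : j ∉ G.Istar m) : G.h j < G.h i := by
  unfold Istar at hi hj
  split_ifs at hi hj with hne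
  · exact h_anti (lt_of_le_of_lt (Finset.mem_Iic.1 hi) (not_le.1 fun hle =>
      hj (Finset.mem_Iic.2 hle)))
  · simp at hi

/-- The arithmetic behind risk dominance, for groups `S` and `T` with common capital `C`, exclusive
capitals `a`, `b` and exclusive members `p`, `q`. -/
lemma riskProduct_le {A F C a b p q : ℝ} (hC : 0 ≤ C) (ha : 0 < a) (hb : 0 < b) (hA : 0 < A)
    (hS : p * F ≤ A * a / (C + a)) (hT : q * F ≤ A * b / (C + b))
    (hSU : A * a / (C + a + b) ≤ p * F) (hTU : A * b / (C + a + b) ≤ q * F)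
    (hkey : (C + b) * (A - q * F) ≤ (C + a) * (A - p * F)) :
    |(A * b / (C + b) - q * F) * (A * a / (C + a + b) - p * F)| ≤
      |(A * a / (C + a) - p * F) * (A * b / (C + a + b) - q * F)| := by
  rw [abs_of_nonpos (mul_nonpos_of_nonneg_of_nonpos (sub_nonneg.2 hT) (sub_nonpos.2 hSU)),
    abs_of_nonpos (mul_nonpos_of_nonneg_of_nonpos (sub_nonneg.2 hS) (sub_nonpos.2 hTU)),
    ← sub_nonneg]
  -- Both products are nonpositive. In their difference the terms in `F ^ 2` cancel and the rest
  -- factors.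
  have h : -((A * a / (C + a) - p * F) * (A * b / (C + a + b) - q * F)) -
      -((A * b / (C + b) - q * F) * (A * a / (C + a + b) - p * F)) =
      A * a * b / ((C + a) * (C + b) * (C + a + b)) *
        ((C + a) * (A - p * F) - (C + b) * (A - q * F)) := by
    have h1 : C + a ≠ 0 := by positivity
    have h2 : C + b ≠ 0 := by positivity
    have h3 : C + a + b ≠ 0 := by positivity
    field_simp
    ring
  rw [h]
  exact mul_nonneg (by positivity) (sub_nonneg.2 hkey)

lemma capital_le_card_mul {P : Finset (Fin N)} {c : ℝ} (hc : ∀ i ∈ P, G.h i ≤ c) :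
    G.capital P ≤ P.card * c := by
  simpa [capital] using Finset.sum_le_card_nsmul P G.h c hc

lemma card_mul_le_capital {P : Finset (Fin N)} {c : ℝ} (hc : ∀ i ∈ P, c ≤ G.h i) :
    P.card * c ≤ G.capital P := by
  simpa [capital] using Finset.card_nsmul_le_sum P G.h c hc

lemma capital_sdiff_add_inter (S T : Finset (Fin N)) :
    G.capital (S ∩ T) + G.capital (S \ T) = G.capital S := by
  rw [add_comm, capital, capital, capital, ← Finset.sum_inter_add_sum_sdiff S T, add_comm]

lemma capital_union (S T : Finset (Fin N)) :
    G.capital (S ∪ T) = G.capital (S ∩ T) + G.capital (S \ T) + G.capital (T \ S) := by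
  rw [capital_sdiff_add_inter, ← Finset.union_sdiff_self_eq_union, capital,
    Finset.sum_union Finset.disjoint_sdiff]
  rfl

/-- The comparison of two equilibria that decides risk dominance. -/
lemma capital_mul_le_of_equilibria (h_pos : ∀ i, 0 < G.h i) {m : ℕ} {S T : Finset (Fin N)}
    (hF : 0 < G.F m) (hA : G.F m < G.netValue m) (hS : G.IsStageEquilibrium m S)
    (hT : G.IsStageEquilibrium m T) (hlt : ∀ i ∈ S \ T, ∀ j ∈ T \ S, G.h j < G.h i)
    (hP : (S \ T).Nonempty) (hQ : (T \ S).Nonempty) :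
    G.capital T * (G.netValue m - (T \ S).card * G.F m) ≤
      G.capital S * (G.netValue m - (S \ T).card * G.F m) := by
  obtain ⟨i, hi, himin⟩ := Finset.exists_min_image (S \ T) G.h hP
  obtain ⟨j, hj, hjmax⟩ := Finset.exists_max_image (T \ S) G.h hQ
  have hij := hlt i hi j hj
  have hi' := Finset.mem_sdiff.1 hi
  have hj' := Finset.mem_sdiff.1 hj
  have hSpos := capital_pos h_pos hi'.1
  have hTpos := capital_pos h_pos hj'.1
  have hSin : G.F m * G.capital S ≤ G.netValue m * G.h i :=
    (stagePayoff_nonneg_iff _ hSpos).1 (hS.1 i hi'.1)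
  have hTout : G.netValue m * G.h i ≤ G.F m * (G.h i + G.capital T) := by
    have := (stagePayoff_nonpos_iff _ (capital_pos h_pos (Finset.mem_insert_self i T))).1
      (hT.2 i hi'.2)
    rwa [capital_insert hi'.2] at this
  have hSout : G.netValue m * G.h j ≤ G.F m * (G.h j + G.capital S) := by
    have := (stagePayoff_nonpos_iff _ (capital_pos h_pos (Finset.mem_insert_self j S))).1
      (hS.2 j hj'.2)
    rwa [capital_insert hj'.2] at this
  have hSsplit := capital_sdiff_add_inter (G := G) S T
  have hTsplit := capital_sdiff_add_inter (G := G) T S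
  rw [Finset.inter_comm] at hTsplit
  have ha := card_mul_le_capital (G := G) himin
  have ha' := card_mul_le_capital (G := G) (P := S \ T) (c := G.h j)
    fun k hk => hij.le.trans (himin k hk)
  have hb := capital_le_card_mul (G := G) hjmax
  have hp1 : (1 : ℝ) ≤ ((S \ T).card : ℝ) := by exact_mod_cast hP.card_pos
  have hq1 : (1 : ℝ) ≤ ((T \ S).card : ℝ) := by exact_mod_cast hQ.card_pos
  have hC := capital_nonneg h_pos (S ∩ T)
  -- Every member of `S` owns at least the fraction `F / netValue` of the capital of `S`, and the
  -- fractions add up to at most one.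
  have hAp : (S \ T).card * G.F m ≤ G.netValue m := by
    have h1 : ∀ k ∈ S \ T, G.F m * G.capital S / G.netValue m ≤ G.h k := fun k hk => by
      rw [div_le_iff₀ (hF.trans hA)]
      have := (stagePayoff_nonneg_iff _ hSpos).1 (hS.1 k (Finset.mem_sdiff.1 hk).1)
      linarith
    have h2 := card_mul_le_capital (G := G) h1
    have h3 : ((S \ T).card : ℝ) * (G.F m * G.capital S / G.netValue m) ≤ G.capital S := by
      linarith
    rw [mul_div_assoc', div_le_iff₀ (hF.trans hA)] at h3
    nlinarith
  set p : ℝ := ((S \ T).card : ℝ)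
  set q : ℝ := ((T \ S).card : ℝ)
  rcases lt_or_ge (T \ S).card (S \ T).card with hcard | hcard
  -- With more exclusive members in `S`, `capital S - capital T` exceeds `h i`. As `i` breaks even
  -- in `S`, this gives `F * capital T < F * (capital S - h i) ≤ (netValue - F) * h i`: she would
  -- gain by joining `T`.
  · exfalso
    have hpq : q + 1 ≤ p := by simp only [p, q]; exact_mod_cast hcard
    have h1 : G.h i < G.capital S - G.capital T := by
      have : q * G.h j < q * G.h i := by nlinarith
      nlinarith [h_pos i]
    have hAF := sub_pos.2 hA
    have h2 : (G.netValue m - G.F m) * G.h i ≤ G.F m * G.capital T := by linarith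
    nlinarith
  · have hpq : p ≤ q := by simp only [p, q]; exact_mod_cast hcard
    rcases le_total (G.capital T) (G.capital S) with hle | hle
    · have : G.netValue m - q * G.F m ≤ G.netValue m - p * G.F m := by nlinarith
      calc _ ≤ G.capital T * (G.netValue m - p * G.F m) :=
            mul_le_mul_of_nonneg_left this hTpos.le
        _ ≤ _ := mul_le_mul_of_nonneg_right hle (by linarith)
    -- The extra capital of `T` comes from its `q - p` additional exclusive members, none stronger
    -- than `j`. That `j` stays out of `S` bounds `h j`, so the additional fixed costs outweigh the
    -- extra capital.
    · have h1 : G.capital T - G.capital S ≤ (q - p) * G.h j := by nlinarith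
      have h2 : (G.netValue m - p * G.F m) * G.h j ≤ G.F m * G.capital S := by
        nlinarith [mul_le_mul_of_nonneg_right (mul_le_mul_of_nonneg_right hp1 hF.le) (h_pos j).le]
      have h3 : (G.capital T - G.capital S) * (G.netValue m - p * G.F m) ≤
          (q - p) * (G.F m * G.capital S) := by
        calc _ ≤ (q - p) * G.h j * (G.netValue m - p * G.F m) :=
              mul_le_mul_of_nonneg_right h1 (by linarith)
          _ = (q - p) * ((G.netValue m - p * G.F m) * G.h j) := by ring
          _ ≤ _ := mul_le_mul_of_nonneg_left h2 (by linarith)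
      have h4 : (q - p) * (G.F m * G.capital S) ≤ (q - p) * (G.F m * G.capital T) :=
        mul_le_mul_of_nonneg_left (mul_le_mul_of_nonneg_left hle hF.le) (by linarith)
      nlinarith

/-- Together with `le_card_mul_of_equilibrium`, this fixes the signs of the four factors in
`riskProduct_le`. -/
lemma card_mul_le_of_equilibrium {m : ℕ} {S P : Finset (Fin N)}
    (hS : G.IsStageEquilibrium m S) (hPS : P ⊆ S) :
    P.card * G.F m ≤ G.netValue m * G.capital P / G.capital S := by
  rw [← sub_nonneg, ← sum_stagePayoff]
  exact Finset.sum_nonneg fun i hi => hS.1 i (hPS hi)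

/-- A single entrant from `Q` already does not gain by joining `S`; the presence of the rest of `Q`
only dilutes her share. -/
lemma le_card_mul_of_equilibrium (h_pos : ∀ i, 0 < G.h i) {m : ℕ} {S Q : Finset (Fin N)}
    (hF : 0 < G.F m) (hS : G.IsStageEquilibrium m S) (hQS : Disjoint Q S) {c : ℝ}
    (hc : G.capital S + G.capital Q = c) : G.netValue m * G.capital Q / c ≤ Q.card * G.F m := by
  rcases Q.eq_empty_or_nonempty with rfl | ⟨k, hk⟩
  · simp [capital]
  have hcpos : 0 < c := by
    have := capital_pos h_pos hk
    have := capital_nonneg h_pos S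
    linarith
  rw [capital, Finset.mul_sum, Finset.sum_div, ← nsmul_eq_mul]
  refine Finset.sum_le_card_nsmul _ _ _ fun j hj => ?_
  have hjS := Finset.disjoint_left.1 hQS hj
  have h1 := (stagePayoff_nonpos_iff _ (capital_pos h_pos (Finset.mem_insert_self j S))).1
    (hS.2 j hjS)
  rw [capital_insert hjS] at h1
  rw [div_le_iff₀ hcpos]
  refine h1.trans (mul_le_mul_of_nonneg_left ?_ hF.le)
  have : G.h j ≤ G.capital Q := Finset.single_le_sum (fun i _ => (h_pos i).le) hj
  linarith

/-- The group `I*_m` is a risk dominant equilibrium. -/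
theorem isRiskDominant_Istar (h_pos : ∀ i, 0 < G.h i) (h_anti : StrictAnti G.h) {m : ℕ}
    (hF : 0 < G.F m) (hA : G.F m < G.netValue m) : G.IsRiskDominant m (G.Istar m) := by
  have hS := isStageEquilibrium_Istar h_pos h_anti hF hA
  refine ⟨hS, fun T hT => ?_⟩
  set S := G.Istar m with hSdef
  -- If one group contains the other, both products have an empty sum as a factor.
  rcases (S \ T).eq_empty_or_nonempty with hP | hP
  · simp [hP]
  rcases (T \ S).eq_empty_or_nonempty with hQ | hQ
  · simp [hQ]
  obtain ⟨i, hi⟩ := id hP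
  obtain ⟨j, hj⟩ := id hQ
  have hkey := capital_mul_le_of_equilibria h_pos hF hA hS hT (fun i hi j hj =>
    lt_of_mem_Istar h_anti (Finset.mem_sdiff.1 hi).1 (Finset.mem_sdiff.1 hj).2) hP hQ
  have hSp := card_mul_le_of_equilibrium hS (Finset.sdiff_subset (s := S) (t := T))
  have hTp := card_mul_le_of_equilibrium hT (Finset.sdiff_subset (s := T) (t := S))
  have hSsplit := capital_sdiff_add_inter (G := G) S T
  have hTsplit := capital_sdiff_add_inter (G := G) T S
  rw [Finset.inter_comm] at hTsplit
  have hU := capital_union (G := G) S T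
  have hSU := le_card_mul_of_equilibrium h_pos hF hT (Finset.sdiff_disjoint (s := T) (t := S))
    (c := G.capital (S ∪ T)) (by linarith)
  have hTU := le_card_mul_of_equilibrium h_pos hF hS (Finset.sdiff_disjoint (s := S) (t := T))
    (c := G.capital (S ∪ T)) (by linarith)
  simp only [sum_stagePayoff]
  rw [hU] at hSU hTU ⊢
  rw [← hSsplit] at hSp hkey ⊢
  rw [← hTsplit] at hTp hkey ⊢
  exact riskProduct_le (capital_nonneg h_pos _) (capital_pos h_pos hi) (capital_pos h_pos hj)
    (hF.trans hA) hSp hTp hSU hTU hkey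

end StageGame

/-! ### Nodes and transitions -/

section Transitions

lemma Node.ext' {s t : Node N} (h1 : s.time = t.time) (h2 : s.pub = t.pub)
    (h3 : ∀ j, s.info j = t.info j) : s = t := by
  cases s; cases t; simp only [Node.mk.injEq]; exact ⟨h1, h2, funext h3⟩

@[simp] lemma Node.advance_time (s : Node N) (u : ℝ≥0) : (s.advance u).time = s.time + u := rfl
@[simp] lemma Node.advance_pub (s : Node N) (u : ℝ≥0) : (s.advance u).pub = s.pub := rfl
@[simp] lemma Node.advance_info (s : Node N) (u : ℝ≥0) : (s.advance u).info = s.info := rfl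
@[simp] lemma Node.solve_time (s : Node N) (j : Fin N) : (s.solve j).time = s.time := rfl
@[simp] lemma Node.solve_pub (s : Node N) (j : Fin N) : (s.solve j).pub = s.pub := rfl

@[simp] lemma Node.advance_zero (s : Node N) : s.advance 0 = s := by
  simp [Node.advance]

@[simp] lemma Node.advance_advance (s : Node N) (u v : ℝ≥0) :
    (s.advance u).advance v = s.advance (u + v) := by
  simp [Node.advance, add_assoc]

lemma Node.solve_info_self (s : Node N) (j : Fin N) : (s.solve j).info j =
    { pub := (s.info j).pub
      know := (s.info j).know + 1
      work := false
      last := s.time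
      record := ⟨s.time, true, none, fun _ => 0⟩ :: (s.info j).record } := by
  simp [Node.solve]

@[simp] lemma Node.solve_info_of_ne (s : Node N) {j k : Fin N} (h : k ≠ j) :
    (s.solve j).info k = s.info k := by
  simp [Node.solve, h]

variable (G : TreasureHunt N)

@[simp] lemma act_time (s : Node N) (a : Fin N → Option Action) : (G.act s a).time = s.time := rfl
@[simp] lemma act_pub (s : Node N) (a : Fin N → Option Action) :
    (G.act s a).pub = s.nextPub a := rfl

lemma act_info_of_silent {s : Node N} {a : Fin N → Option Action} {j : Fin N} (hj : a j = none)
    (hp : s.nextPub a = s.pub) : (G.act s a).info j = s.info j := by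
  simp [act, hj, hp]

lemma act_info_of_not {s : Node N} {a : Fin N → Option Action} {j : Fin N}
    (hj : ¬ (a j = none ∧ s.nextPub a = s.pub)) : (G.act s a).info j =
      { pub := s.nextPub a
        know := max (s.info j).know (s.nextPub a)
        work := decide (s.nextPub a ≤ (s.info j).know) && G.nextWork s a j
        last := s.time
        record := ⟨s.time, false, a j, s.level a⟩ :: (s.info j).record } := by
  simp only [act, Option.isNone_iff_eq_none, if_neg hj]

lemma pub_le_nextPub (s : Node N) (a : Fin N → Option Action) : s.pub ≤ s.nextPub a :=
  le_max_left _ _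

lemma level_le_know (s : Node N) (a : Fin N → Option Action) (j : Fin N) :
    s.level a j ≤ (s.info j).know := by
  unfold Node.level
  split
  · split_ifs <;> simp
  · simp

lemma pub_lt_level {s : Node N} {a : Fin N → Option Action} {j : Fin N}
    (h : 0 < s.level a j) : s.pub < s.level a j := by
  unfold Node.level at h ⊢
  split at h
  · split_ifs at h ⊢ with h1
    · exact h1
    · exact absurd h (lt_irrefl 0)
  · simp at h

lemma level_publish {s : Node N} {a : Fin N → Option Action} {j : Fin N} {r : ℕ}
    (h : a j = some (Action.publish r)) : s.level a j =
      if s.pub < min r (s.info j).know then min r (s.info j).know else 0 := by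
  simp [Node.level, h]

/-- The profile `a` contains no publication, except possibly one by `i`. -/
def Quiet (i : Fin N) (a : Fin N → Option Action) : Prop :=
  ∀ j, j ≠ i → a j = none ∨ a j = some Action.enter

lemma level_eq_zero {s : Node N} {a : Fin N → Option Action} {j : Fin N}
    (h : a j = none ∨ a j = some Action.enter) : s.level a j = 0 := by
  rcases h with h | h <;> simp [Node.level, h]

lemma sup_level_of_forall_ne {s : Node N} {a : Fin N → Option Action} {i : Fin N}
    (h : ∀ j, j ≠ i → s.level a j = 0) : Finset.univ.sup (s.level a) = s.level a i := by
  refine le_antisymm (Finset.sup_le fun j _ => ?_) (Finset.le_sup (Finset.mem_univ i))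
  by_cases hj : j = i
  · rw [hj]
  · simp [h j hj]

lemma nextPub_of_quiet {s : Node N} {a : Fin N → Option Action} {i : Fin N} (ha : Quiet i a) :
    s.nextPub a = max s.pub (s.level a i) := by
  rw [Node.nextPub, sup_level_of_forall_ne fun j hj => level_eq_zero (ha j hj)]

lemma nextPub_of_none {s : Node N} {a : Fin N → Option Action} {i : Fin N} (ha : Quiet i a)
    (hi : a i = none ∨ a i = some Action.enter) : s.nextPub a = s.pub := by
  rw [nextPub_of_quiet ha, level_eq_zero hi]; simp

lemma nextPub_congr {s t : Node N} {a b : Fin N → Option Action} (hp : s.pub = t.pub)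
    (hl : s.level a = t.level b) : s.nextPub a = t.nextPub b := by
  rw [Node.nextPub, Node.nextPub, hp, hl]

lemma act_none (s : Node N) : G.act s (fun _ => none) = s := by
  have hp : s.nextPub (fun _ => none) = s.pub := by
    have : s.level (fun _ => none) = fun _ => 0 := funext fun j => level_eq_zero (Or.inl rfl)
    rw [Node.nextPub, this]; simp
  exact Node.ext' rfl hp fun j => act_info_of_silent G rfl hp

end Transitions

/-! ### Coherence of reachable nodes -/

section Coherence

variable (G : TreasureHunt N)

/-- What the information of `j` has in common with the node. -/
structure Coherent (s : Node N) (j : Fin N) : Prop where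
  pub_eq : (s.info j).pub = s.pub
  pub_le : s.pub ≤ (s.info j).know
  know_le : (s.info j).know ≤ G.M
  know_lt : (s.info j).work = true → (s.info j).know < G.M
  last_le : (s.info j).last ≤ s.time

variable {G}

lemma Coherent.pub_le_M {s : Node N} {j : Fin N} (h : G.Coherent s j) : s.pub ≤ G.M :=
  h.pub_le.trans h.know_le

lemma nextPub_le {s : Node N} (h : ∀ j, G.Coherent s j) (a : Fin N → Option Action) (j : Fin N) :
    s.nextPub a ≤ G.M :=
  max_le (h j).pub_le_M (Finset.sup_le fun k _ => (level_le_know s a k).trans (h k).know_le)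

lemma Reachable.coherent {s : Node N} (hs : G.Reachable s) : ∀ j, G.Coherent s j := by
  induction hs with
  | initial => intro j; constructor <;> simp [Node.initial]
  | advance s u _ ih =>
    intro j
    exact ⟨(ih j).pub_eq, (ih j).pub_le, (ih j).know_le, (ih j).know_lt,
      (ih j).last_le.trans (by simp)⟩
  | solve s k _ hk ih =>
    intro j
    by_cases hj : j = k
    · subst hj
      have hlt := (ih j).know_lt hk
      have hle := (ih j).pub_le
      constructor <;> rw [Node.solve_info_self] <;> simp
      · exact (ih j).pub_eq
      · omega
      · omega
    · have hinfo := Node.solve_info_of_ne s hj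
      constructor <;> rw [hinfo]
      exacts [(ih j).pub_eq, (ih j).pub_le, (ih j).know_le, (ih j).know_lt, (ih j).last_le]
  | act s a _ ih =>
    intro j
    by_cases hj : a j = none ∧ s.nextPub a = s.pub
    · have hinfo := act_info_of_silent G hj.1 hj.2
      constructor <;> rw [hinfo]
      · rw [act_pub, hj.2]; exact (ih j).pub_eq
      · rw [act_pub, hj.2]; exact (ih j).pub_le
      · exact (ih j).know_le
      · exact (ih j).know_lt
      · exact (ih j).last_le
    · have hinfo := act_info_of_not G hj
      have hM := nextPub_le ih a j
      constructor <;> rw [hinfo] <;> simp only [act_pub, act_time, le_refl]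
      · exact le_max_right _ _
      · exact max_le (ih j).know_le hM
      · intro hw
        rw [Bool.and_eq_true, decide_eq_true_eq] at hw
        rw [max_eq_left hw.1]
        have h2 := hw.2
        unfold nextWork at h2
        split at h2
        · simpa using h2
        · simp at h2
        · exact (ih j).know_lt h2

end Coherence

/-! ### Alarms, gaps and due actions -/

section Timing

lemma gap_le (σ : Fin N → Strategy N) (s : Node N) (j : Fin N) :
    gap σ s ≤ alarm (σ j) (s.info j) - s.time :=
  tsub_le_tsub_right (iInf_le _ j) _

lemma gap_eq_zero {σ : Fin N → Strategy N} {s : Node N} {j : Fin N}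
    (h : alarm (σ j) (s.info j) ≤ s.time) : gap σ s = 0 :=
  le_antisymm ((gap_le σ s j).trans (tsub_eq_zero_of_le h).le) zero_le

lemma lt_alarm_of_lt_gap {σ : Fin N → Strategy N} {s : Node N} {u : ℝ≥0}
    (h : (u : ℝ≥0∞) < gap σ s) (j : Fin N) : ((s.time + u : ℝ≥0) : ℝ≥0∞) <
      alarm (σ j) (s.info j) := by
  have := lt_tsub_iff_left.1 (h.trans_le (gap_le σ s j))
  simpa using this

lemma not_due_of_gap_ne_zero {σ : Fin N → Strategy N} {s : Node N} (hg : gap σ s ≠ 0)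
    (j : Fin N) : (s.time : ℝ≥0∞) < alarm (σ j) (s.info j) := by
  simpa using lt_alarm_of_lt_gap (u := 0) (by simpa using pos_iff_ne_zero.2 hg) j

lemma gap_of_forall_ne {σ : Fin N → Strategy N} {s : Node N} {i : Fin N}
    (h : ∀ j, j ≠ i → alarm (σ j) (s.info j) = ⊤) :
    gap σ s = alarm (σ i) (s.info i) - s.time := by
  have : ⨅ j, alarm (σ j) (s.info j) = alarm (σ i) (s.info i) := by
    refine le_antisymm (iInf_le _ i) (le_iInf fun j => ?_)
    by_cases hj : j = i
    · rw [hj]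
    · rw [h j hj]; exact le_top
  rw [gap, this]

lemma due_eq_none {σ : Fin N → Strategy N} {s : Node N} {j : Fin N}
    (h : (s.time : ℝ≥0∞) < alarm (σ j) (s.info j)) : due σ s j = none := by
  rw [due, if_neg (not_le.2 h)]

lemma due_eq_some {σ : Fin N → Strategy N} {s : Node N} {j : Fin N}
    (h : alarm (σ j) (s.info j) ≤ s.time) : due σ s j = some (σ j (s.info j)).2 := by
  rw [due, if_pos h]

@[simp] lemma due_update_of_ne (σ : Fin N → Strategy N) (τ : Strategy N) (s : Node N)
    {i j : Fin N} (h : j ≠ i) : due (Function.update σ i τ) s j = due σ s j := by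
  simp [due, h]

lemma actNode_of_gap_eq_zero {σ : Fin N → Strategy N} {s : Node N} (h : gap σ s = 0) :
    actNode σ s = s := by
  simp [actNode, h]

end Timing

/-! ### Opponents who follow the profile `σ*` -/

section Opponents

variable (G : TreasureHunt N)

/-- The opponents of `i` who are to work on the current stage do so, and they have no unpublished
results. -/
def Calm (i : Fin N) (s : Node N) : Prop :=
  ∀ j, j ≠ i → (s.info j).know = s.pub ∧
    ((s.info j).work = true ↔ s.pub < G.M ∧ j ∈ G.Istar s.pub)

/-- The opponents of `i` have just received a new entry in their records, they do not work, and
they have no unpublished results. -/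
def Fresh (i : Fin N) (s : Node N) : Prop :=
  ∀ j, j ≠ i → (s.info j).know = s.pub ∧ (s.info j).work = false ∧ (s.info j).last = s.time

/-- A node in which the opponents of `i` have behaved as prescribed by `σ*`. -/
def Compliant (i : Fin N) (s : Node N) : Prop := G.Calm i s ∨ Fresh i s

variable {G}

lemma sigmaStar_of_eq {j : Fin N} {I : Info N} (h : I.pub = I.know) : G.sigmaStar j I =
    if I.work = false ∧ I.know < G.M ∧ j ∈ G.Istar I.know then (0, Action.enter)
      else (⊤, Action.enter) := by
  rw [sigmaStar, if_neg (by omega)]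

lemma Compliant.know_eq {i : Fin N} {s : Node N} (h : G.Compliant i s) {j : Fin N} (hj : j ≠ i) :
    (s.info j).know = s.pub := by
  rcases h with h | h <;> exact (h j hj).1

/-- Calm rivals have nothing to publish, and those who should work already do, so they wait forever.
Until the next solution, only `i` can act. -/
lemma Calm.alarm_eq_top {i : Fin N} {s : Node N} (h : G.Calm i s) {j : Fin N} (hj : j ≠ i)
    (hc : G.Coherent s j) : alarm (G.sigmaStar j) (s.info j) = ⊤ := by
  have hk := (h j hj).1
  have hw := (h j hj).2
  rw [alarm, sigmaStar_of_eq (hc.pub_eq.trans hk.symm), hk, if_neg]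
  · simp
  · rintro ⟨h1, h2⟩
    rw [hw.2 h2] at h1
    exact absurd h1 (by simp)

lemma Calm.due_eq_none {i : Fin N} {s : Node N} (h : G.Calm i s) {j : Fin N} (hj : j ≠ i)
    (hc : G.Coherent s j) : due G.sigmaStar s j = none :=
  TreasureHunt.due_eq_none (by rw [h.alarm_eq_top hj hc]; exact ENNReal.coe_lt_top)

-- The last entry of `j` bears the present date, so an action prescribed with delay zero is due
-- exactly now.
open Classical in
lemma Fresh.due_eq {i : Fin N} {s : Node N} (h : Fresh i s) {j : Fin N} (hj : j ≠ i)
    (hc : G.Coherent s j) : due G.sigmaStar s j =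
      if s.pub < G.M ∧ j ∈ G.Istar s.pub then some Action.enter else none := by
  obtain ⟨hk, hw, hl⟩ := h j hj
  have hσ := sigmaStar_of_eq (G := G) (j := j) (hc.pub_eq.trans hk.symm)
  rw [hk, hw] at hσ
  by_cases hd : s.pub < G.M ∧ j ∈ G.Istar s.pub
  · rw [if_pos ⟨rfl, hd⟩] at hσ
    rw [if_pos hd, due_eq_some, hσ]
    simp [alarm, hσ, hl]
  · rw [if_neg fun h => hd h.2] at hσ
    rw [if_neg hd, TreasureHunt.due_eq_none]
    simp [alarm, hσ]

lemma Compliant.due_eq {i : Fin N} {s : Node N} (h : G.Compliant i s)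
    (hc : ∀ j, G.Coherent s j) : Quiet i (due G.sigmaStar s) := by
  intro j hj
  rcases h with h | h
  · exact Or.inl (h.due_eq_none hj (hc j))
  · rw [h.due_eq hj (hc j)]; split_ifs <;> simp

/-- If no opponent of `i` is due, the opponents are calm. -/
lemma Compliant.calm_of_not_due {i : Fin N} {s : Node N} (h : G.Compliant i s)
    (hc : ∀ j, G.Coherent s j) (hd : ∀ j, j ≠ i → due G.sigmaStar s j = none) : G.Calm i s := by
  rcases h with h | h
  · exact h
  · intro j hj
    refine ⟨(h j hj).1, ?_⟩
    have h1 := hd j hj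
    rw [h.due_eq hj (hc j)] at h1
    rw [(h j hj).2.1]
    split_ifs at h1 with h2
    simp [h2]

lemma Calm.advance {i : Fin N} {s : Node N} (h : G.Calm i s) (u : ℝ≥0) : G.Calm i (s.advance u) :=
  h

lemma Compliant.solve_self {i : Fin N} {s : Node N} (h : G.Compliant i s) :
    G.Compliant i (s.solve i) := by
  rcases h with h | h
  · left; intro j hj; rw [Node.solve_info_of_ne s hj]; exact h j hj
  · right; intro j hj; rw [Node.solve_info_of_ne s hj]; exact h j hj

/-- A publication makes a new entry in every record. It interrupts work on the stages it covers, so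
rivals at or below the new level start again from there. -/
lemma fresh_act {i : Fin N} {s : Node N} {a : Fin N → Option Action} (hp : s.nextPub a ≠ s.pub)
    (hj : ∀ j, j ≠ i → (s.info j).know < s.nextPub a ∨
      (s.info j).know = s.nextPub a ∧ G.nextWork s a j = false) : Fresh i (G.act s a) := by
  intro j hji
  rw [act_info_of_not G fun h => hp h.2]
  rcases hj j hji with h | ⟨h, h'⟩
  · simp [h.le, h]
  · simp [h, h']

/-- If the opponents of `i` are due to enter and nothing is published, they are calm afterwards. -/
lemma Compliant.calm_act {i : Fin N} {s : Node N} {a : Fin N → Option Action}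
    (h : G.Compliant i s) (hc : ∀ j, G.Coherent s j) (ha : ∀ j, j ≠ i → a j = due G.sigmaStar s j)
    (hp : s.nextPub a = s.pub) : G.Calm i (G.act s a) := by
  rcases h with h | h
  · intro j hj
    have hj' : a j = none := (ha j hj).trans (h.due_eq_none hj (hc j))
    rw [act_info_of_silent G hj' hp, act_pub, hp]
    exact h j hj
  · intro j hj
    have hj' := (ha j hj).trans (h.due_eq hj (hc j))
    obtain ⟨hk, hw, hl⟩ := h j hj
    split_ifs at hj' with hd
    · rw [act_info_of_not G (by simp [hj']), act_pub, hp]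
      simp [hk, nextWork, hj', hd]
    · rw [act_info_of_silent G hj' hp, act_pub, hp, hw]
      simpa [hk] using hd

/-- Opponents who act as prescribed remain compliant, whatever `i` does. -/
lemma Compliant.act {i : Fin N} {s : Node N} {a : Fin N → Option Action} (h : G.Compliant i s)
    (hc : ∀ j, G.Coherent s j) (ha : ∀ j, j ≠ i → a j = due G.sigmaStar s j) :
    G.Compliant i (G.act s a) := by
  by_cases hp : s.nextPub a = s.pub
  · exact Or.inl (h.calm_act hc ha hp)
  · right
    refine fresh_act hp fun j hj => Or.inl ?_
    rw [h.know_eq hj]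
    exact lt_of_le_of_ne (pub_le_nextPub s a) (Ne.symm hp)

end Opponents

/-! ### Reconstruction of a node from the record of one scientist

A scientist `i` who sees something unexpected explains it in the simplest way: at every date her
opponents have behaved as prescribed by `σ*`, and an opponent who publishes more than she could
have found that way has found it at the moment of publication. -/

section Replay

/-- The information of a scientist who starts working on her first unsolved stage (unless she does
so already) and solves it at once, at date `t`. -/
def learn (t : ℝ≥0) (I : Info N) : Info N where
  pub := I.pub
  know := I.know + 1
  work := false
  last := t
  record := ⟨t, true, none, fun _ => 0⟩ ::
    (if I.work = true then I.record else ⟨t, false, some Action.enter, fun _ => 0⟩ :: I.record)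

/-- The opponents `j` of `i` solve all stages `< p j` at once. -/
def prepare (i : Fin N) (p : Fin N → ℕ) (s : Node N) : Node N :=
  { s with info := fun j =>
      (learn s.time)^[if j = i then 0 else p j - (s.info j).know] (s.info j) }

variable (G : TreasureHunt N)

/-- The opponents of `i` take the actions that are due. -/
noncomputable def settle (i : Fin N) (s : Node N) : Node N :=
  G.act s fun j => if j = i then none else due G.sigmaStar s j

/-- Nothing happens until the date `t`, except that the opponents of `i` take the actions that are
due before. -/
noncomputable def wait (i : Fin N) (t : ℝ≥0) (s : Node N) : Node N :=
  if t = s.time then s else (G.settle i s).advance (t - s.time)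

/-- The actions that explain an entry in the record of `i`. -/
noncomputable def replayActs (i : Fin N) (e : Entry N) (s : Node N) (j : Fin N) : Option Action :=
  if j = i then e.act else
    if 0 < e.pubs j then some (Action.publish (e.pubs j)) else due G.sigmaStar s j

/-- The event that explains an entry in the record of `i`. -/
noncomputable def replayStep (i : Fin N) (e : Entry N) (s : Node N) : Node N :=
  if e.solved = true then s.solve i else G.act (prepare i e.pubs s) (G.replayActs i e s)

/-- The node that `i` imagines right after the last entry in her record. -/
noncomputable def replay (i : Fin N) : List (Entry N) → Node N
  | [] => Node.initial
  | e :: l => G.replayStep i e (G.wait i e.time (replay i l))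

lemma learn_iterate_know (t : ℝ≥0) (I : Info N) (n : ℕ) :
    ((learn t)^[n] I).know = I.know + n := by
  induction n with
  | zero => rfl
  | succ n ih => rw [Function.iterate_succ_apply', learn, ih]; rfl

lemma learn_iterate_work (t : ℝ≥0) (I : Info N) {n : ℕ} (hn : n ≠ 0) :
    ((learn t)^[n] I).work = false := by
  obtain ⟨n, rfl⟩ := Nat.exists_eq_succ_of_ne_zero hn
  rw [Function.iterate_succ_apply', learn]

@[simp] lemma prepare_time (i : Fin N) (p : Fin N → ℕ) (s : Node N) :
    (prepare i p s).time = s.time := rfl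
@[simp] lemma prepare_info_self (i : Fin N) (p : Fin N → ℕ) (s : Node N) :
    (prepare i p s).info i = s.info i := by simp [prepare]

lemma prepare_info_of_le {i : Fin N} {p : Fin N → ℕ} {s : Node N} {j : Fin N}
    (h : p j ≤ (s.info j).know) : (prepare i p s).info j = s.info j := by
  simp [prepare, Nat.sub_eq_zero_of_le h]

lemma prepare_know {i : Fin N} {p : Fin N → ℕ} {s : Node N} {j : Fin N} (hj : j ≠ i)
    (h : (s.info j).know ≤ p j) : ((prepare i p s).info j).know = p j := by
  simp only [prepare, if_neg hj, learn_iterate_know]; omega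

lemma prepare_work {i : Fin N} {p : Fin N → ℕ} {s : Node N} {j : Fin N} (hj : j ≠ i)
    (h : (s.info j).know < p j) : ((prepare i p s).info j).work = false := by
  simp only [prepare, if_neg hj]
  exact learn_iterate_work _ _ (by omega)

variable {G}

/-- The tree lets a scientist solve a stage without any time passing. `learn` is one `solve`,
preceded by an `enter` if she is idle, so invented discoveries do not leave the tree. -/
lemma Reachable.learn {s : Node N} (hs : G.Reachable s) {j : Fin N}
    (hj : (s.info j).know < G.M) : G.Reachable
      { s with info := Function.update s.info j (learn s.time (s.info j)) } := by
  by_cases hw : (s.info j).work = true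
  · convert Reachable.solve s j hs hw using 1
    refine Node.ext' rfl rfl fun k => ?_
    by_cases hk : k = j
    · subst hk; rw [Node.solve_info_self]; simp [TreasureHunt.learn, hw]
    · simp [hk]
  · set a : Fin N → Option Action := Function.update (fun _ => none) j (some Action.enter) with ha
    have hq : Quiet j a := fun k hk => by simp [ha, hk]
    have haj : a j = some Action.enter := by simp [ha]
    have hp : s.nextPub a = s.pub := nextPub_of_none hq (Or.inr haj)
    have hlev : s.level a = fun _ => 0 := funext fun k => level_eq_zero <| by
      by_cases hk : k = j
      · subst hk; exact Or.inr haj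
      · exact hq k hk
    have hc := hs.coherent j
    have hinfo := act_info_of_not G (s := s) (a := a) (j := j) (by simp [haj])
    rw [hp, hlev, haj, max_eq_left hc.pub_le, decide_eq_true hc.pub_le] at hinfo
    have hwork : ((G.act s a).info j).work = true := by
      rw [hinfo]; simp [nextWork, haj, hj]
    convert Reachable.solve _ j (Reachable.act s a hs) hwork using 1
    refine Node.ext' rfl hp.symm fun k => ?_
    by_cases hk : k = j
    · subst hk
      rw [Node.solve_info_self, hinfo]
      simp [TreasureHunt.learn, hw, hc.pub_eq]
    · rw [Node.solve_info_of_ne _ hk, act_info_of_silent G (by simp [ha, hk]) hp]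
      simp [hk]

lemma Reachable.learn_iterate {s : Node N} (hs : G.Reachable s) (j : Fin N) (n : ℕ)
    (hn : n = 0 ∨ (s.info j).know + n ≤ G.M) : G.Reachable
      { s with info := Function.update s.info j ((TreasureHunt.learn s.time)^[n] (s.info j)) } := by
  induction n with
  | zero => simpa using hs
  | succ n ih =>
    have hn' : (s.info j).know + (n + 1) ≤ G.M := by omega
    have := (ih (Or.inr (by omega))).learn (j := j) (by
      simp only [Function.update_self, learn_iterate_know]; omega)
    simpa [Function.iterate_succ_apply'] using this

/-- Private discoveries change nobody else's information, so the rivals can make them one after the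
other. -/
lemma Reachable.prepare {s : Node N} (hs : G.Reachable s) (i : Fin N) {p : Fin N → ℕ}
    (hp : ∀ j, p j ≤ G.M) : G.Reachable (prepare i p s) := by
  classical
  have key : ∀ A : Finset (Fin N), G.Reachable { s with info := fun j => (if j ∈ A then
      (TreasureHunt.learn s.time)^[if j = i then 0 else p j - (s.info j).know] (s.info j)
        else s.info j) } := by
    intro A
    induction A using Finset.induction_on with
    | empty => simpa using hs
    | insert k A hk ih =>
      have := ih.learn_iterate k (if k = i then 0 else p k - (s.info k).know) (by
        simp only [hk, if_false]
        have := hp k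
        split_ifs <;> omega)
      convert this using 1
      refine Node.ext' rfl rfl fun j => ?_
      by_cases hj : j = k
      · subst hj; simp [hk]
      · simp [hj]
  simpa [TreasureHunt.prepare] using key Finset.univ

lemma settle_quiet {i : Fin N} {s : Node N} (h : G.Compliant i s) (hc : ∀ j, G.Coherent s j) :
    Quiet i fun j => if j = i then none else due G.sigmaStar s j := by
  intro j hj
  simpa [hj] using h.due_eq hc j hj

lemma settle_nextPub {i : Fin N} {s : Node N} (h : G.Compliant i s) (hc : ∀ j, G.Coherent s j) :
    s.nextPub (fun j => if j = i then none else due G.sigmaStar s j) = s.pub :=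
  nextPub_of_none (settle_quiet h hc) (by simp)

lemma settle_pub {i : Fin N} {s : Node N} (h : G.Compliant i s) (hc : ∀ j, G.Coherent s j) :
    (G.settle i s).pub = s.pub := settle_nextPub h hc

@[simp] lemma settle_time (i : Fin N) (s : Node N) : (G.settle i s).time = s.time := rfl

lemma settle_info_self {i : Fin N} {s : Node N} (h : G.Compliant i s)
    (hc : ∀ j, G.Coherent s j) : (G.settle i s).info i = s.info i :=
  act_info_of_silent G (by simp) (settle_nextPub h hc)

lemma settle_calm {i : Fin N} {s : Node N} (h : G.Compliant i s) (hc : ∀ j, G.Coherent s j) :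
    G.Calm i (G.settle i s) :=
  h.calm_act hc (fun j hj => by simp [hj]) (settle_nextPub h hc)

lemma settle_of_calm {i : Fin N} {s : Node N} (h : G.Calm i s) (hc : ∀ j, G.Coherent s j) :
    G.settle i s = s := by
  have : (fun j => if j = i then none else due G.sigmaStar s j) = fun _ => none := by
    funext j
    split_ifs with hj
    · rfl
    · exact h.due_eq_none hj (hc j)
  rw [settle, this, act_none]

lemma Reachable.settle {s : Node N} (hs : G.Reachable s) (i : Fin N) :
    G.Reachable (G.settle i s) := hs.act _ _

lemma wait_self {i : Fin N} {s : Node N} : G.wait i s.time s = s := if_pos rfl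

lemma wait_of_lt {i : Fin N} {s : Node N} {t : ℝ≥0} (h : s.time < t) :
    G.wait i t s = (G.settle i s).advance (t - s.time) := if_neg h.ne'

/-- What the node imagined by `i` has in common with any node in the information set. -/
structure Explains (G : TreasureHunt N) (i : Fin N) (c : Node N) (I : Info N) (m : ℕ) : Prop where
  reachable : G.Reachable c
  info_eq : c.info i = I
  pub_eq : c.pub = m
  compliant : G.Compliant i c

lemma Explains.coherent {i : Fin N} {c : Node N} {I : Info N} {m : ℕ} (h : G.Explains i c I m) :
    ∀ j, G.Coherent c j := h.reachable.coherent

lemma Explains.settle {i : Fin N} {c : Node N} {I : Info N} {m : ℕ} (h : G.Explains i c I m) :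
    G.Explains i (G.settle i c) I m where
  reachable := h.reachable.settle i
  info_eq := (settle_info_self h.compliant h.coherent).trans h.info_eq
  pub_eq := (settle_pub h.compliant h.coherent).trans h.pub_eq
  compliant := Or.inl (settle_calm h.compliant h.coherent)

lemma Explains.settle_advance {i : Fin N} {c : Node N} {I : Info N} {m : ℕ}
    (h : G.Explains i c I m) (u : ℝ≥0) : G.Explains i ((G.settle i c).advance u) I m where
  reachable := h.settle.reachable.advance _ u
  info_eq := h.settle.info_eq
  pub_eq := h.settle.pub_eq
  compliant := Or.inl (settle_calm h.compliant h.coherent)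

lemma Explains.wait {i : Fin N} {c : Node N} {I : Info N} {m : ℕ} (h : G.Explains i c I m)
    (t : ℝ≥0) : G.Explains i (G.wait i t c) I m := by
  by_cases ht : t = c.time
  · rwa [ht, wait_self]
  · rw [TreasureHunt.wait, if_neg ht]
    exact h.settle_advance _

lemma wait_time {i : Fin N} {c : Node N} {t : ℝ≥0} (h : c.time ≤ t) :
    (G.wait i t c).time = t := by
  rcases h.eq_or_lt with rfl | h'
  · rw [wait_self]
  · rw [wait_of_lt h']; simp [h]

/-- An explanation of the information before an event explains it afterwards. -/
lemma Explains.replayStep_act {i : Fin N} {c s : Node N} (h : G.Explains i c (s.info i) s.pub)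
    (ht : c.time = s.time) (hs : ∀ j, G.Coherent s j) (a : Fin N → Option Action)
    (ha : ¬ (a i = none ∧ s.nextPub a = s.pub)) :
    G.Explains i (G.replayStep i ⟨s.time, false, a i, s.level a⟩ c) ((G.act s a).info i)
      (G.act s a).pub := by
  set e : Entry N := ⟨s.time, false, a i, s.level a⟩ with he
  set b := G.replayActs i e c with hb
  set w := prepare i (s.level a) c with hw
  have hstep : G.replayStep i e c = G.act w b := rfl
  have hdue := h.compliant.due_eq h.coherent
  have hlt : ∀ j, j ≠ i → 0 < s.level a j → (c.info j).know < s.level a j := fun j hj h0 => by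
    rw [h.compliant.know_eq hj, h.pub_eq]; exact pub_lt_level h0
  have hbpub : ∀ j, j ≠ i → 0 < s.level a j → b j = some (Action.publish (s.level a j)) :=
    fun j hj h0 => by simp [hb, replayActs, hj, he, h0]
  have hbdue : ∀ j, j ≠ i → s.level a j = 0 → b j = due G.sigmaStar c j :=
    fun j hj h0 => by simp [hb, replayActs, hj, he, h0]
  have hbi : b i = a i := by simp [hb, replayActs, he]
  have hwi : w.info i = s.info i := by rw [hw, prepare_info_self, h.info_eq]
  have hwp : w.pub = s.pub := h.pub_eq
  have hlev : w.level b = s.level a := by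
    funext j
    by_cases hj : j = i
    · subst hj; simp only [Node.level, hbi, hwi, hwp]
    · rcases Nat.eq_zero_or_pos (s.level a j) with h0 | h0
      · rw [h0]; exact level_eq_zero (by rw [hbdue j hj h0]; exact hdue j hj)
      · have hk : (w.info j).know = s.level a j := prepare_know hj (hlt j hj h0).le
        have := pub_lt_level h0
        rw [level_publish (hbpub j hj h0), hk, min_self, hwp, if_pos this]
  have hnp : w.nextPub b = s.nextPub a := nextPub_congr hwp hlev
  have hb' : ¬ (b i = none ∧ w.nextPub b = w.pub) := by rwa [hbi, hnp, hwp]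
  rw [hstep]
  refine ⟨Reachable.act w b (h.reachable.prepare i fun j =>
    (level_le_know s a j).trans (hs j).know_le), ?_, hnp, ?_⟩
  · rw [act_info_of_not G hb', act_info_of_not G ha, hlev, hbi, hwi, hnp]
    have : G.nextWork w b i = G.nextWork s a i := by simp only [nextWork, hbi, hwi]
    rw [this, show w.time = s.time from ht]
  -- Without a rival's publication nothing is invented and the rivals act as prescribed. With one,
  -- the published level rises and all rivals become fresh, whatever they did before.
  · by_cases hq : ∀ j, j ≠ i → s.level a j = 0
    · have hwc : w = c := Node.ext' rfl rfl fun j => by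
        by_cases hj : j = i
        · subst hj; rw [hw, prepare_info_self]
        · exact prepare_info_of_le (by simp [hq j hj])
      rw [hwc]
      exact h.compliant.act h.coherent fun j hj => hbdue j hj (hq j hj)
    · push Not at hq
      obtain ⟨k, hk, hk0⟩ := hq
      have hp : s.pub < s.nextPub a := lt_of_lt_of_le (pub_lt_level (Nat.pos_of_ne_zero hk0))
        ((Finset.le_sup (f := s.level a) (Finset.mem_univ k)).trans (le_max_right _ _))
      right
      refine fresh_act (by rw [hnp, hwp]; exact hp.ne') fun j hj => ?_
      rw [hnp]
      rcases Nat.eq_zero_or_pos (s.level a j) with h0 | h0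
      · left
        rw [hw, prepare_info_of_le (by simp [h0]), h.compliant.know_eq hj, h.pub_eq]
        exact hp
      · have hkj : (w.info j).know = s.level a j := prepare_know hj (hlt j hj h0).le
        have hle : s.level a j ≤ s.nextPub a :=
          (Finset.le_sup (f := s.level a) (Finset.mem_univ j)).trans (le_max_right _ _)
        rw [hkj]
        refine hle.lt_or_eq.imp_right fun h => ⟨h, ?_⟩
        simp only [nextWork, hbpub j hj h0]
        exact prepare_work hj (hlt j hj h0)

lemma Explains.solve {i : Fin N} {c s : Node N} (h : G.Explains i c (s.info i) s.pub)
    (ht : c.time = s.time) (hw : (s.info i).work = true) :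
    G.Explains i (c.solve i) ((s.solve i).info i) s.pub := by
  refine ⟨h.reachable.solve _ _ (by rw [h.info_eq, hw]), ?_, h.pub_eq, h.compliant.solve_self⟩
  rw [Node.solve_info_self, Node.solve_info_self, h.info_eq, ht]

/-- Every reachable node is explained by the node that `i` imagines. -/
theorem Reachable.explains {s : Node N} (hs : G.Reachable s) (i : Fin N) :
    G.Explains i (G.replay i (s.info i).record) (s.info i) s.pub ∧
      (G.replay i (s.info i).record).time = (s.info i).last := by
  induction hs with
  | initial =>
    refine ⟨⟨Reachable.initial, rfl, rfl, Or.inr ?_⟩, rfl⟩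
    intro j _
    simp [Node.initial, replay]
  | advance s u _ ih => exact ih
  | solve s j hs hw ih =>
    by_cases hj : i = j
    · subst hj
      have hle := (hs.coherent i).last_le
      rw [← ih.2] at hle
      have h1 := (ih.1.wait s.time).solve (wait_time hle) hw
      have h2 : G.replay i ((s.solve i).info i).record =
          (G.wait i s.time (G.replay i (s.info i).record)).solve i := by
        rw [Node.solve_info_self]
        simp [replay, replayStep]
      rw [h2]
      refine ⟨h1, ?_⟩
      rw [Node.solve_info_self, Node.solve_time, wait_time hle]
    · rw [Node.solve_info_of_ne s hj]; exact ih
  | act s a hs ih =>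
    by_cases ha : a i = none ∧ s.nextPub a = s.pub
    · rw [act_info_of_silent G ha.1 ha.2, act_pub, ha.2]; exact ih
    · have hle := (hs.coherent i).last_le
      rw [← ih.2] at hle
      have h1 := (ih.1.wait s.time).replayStep_act (wait_time hle) hs.coherent a ha
      have h2 : G.replay i ((G.act s a).info i).record = G.replayStep i
          ⟨s.time, false, a i, s.level a⟩ (G.wait i s.time (G.replay i (s.info i).record)) := by
        rw [act_info_of_not G ha]; rfl
      rw [h2]
      refine ⟨h1, ?_⟩
      rw [act_info_of_not G ha]
      simp [replayStep, wait_time hle]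

end Replay

/-! ### Play against opponents who follow `σ*` -/

section Play

variable (G : TreasureHunt N)

lemma measurableSet_window (c : ℝ≥0∞) : MeasurableSet {u : ℝ | 0 < u ∧ ENNReal.ofReal u < c} :=
  measurableSet_Ioi.inter (measurableSet_lt ENNReal.measurable_ofReal measurable_const)

/-- Only possible next nodes count: an idle scientist has rate zero, and solutions come strictly
before the planned action and the deadline `c`. -/
lemma next_congr {σ : Fin N → Strategy N} {c : ℝ≥0∞} {f g : Node N → ℝ≥0∞} {s : Node N}
    (hsolve : ∀ j (v : ℝ≥0), 0 < v → (v : ℝ≥0∞) < gap σ s → (v : ℝ≥0∞) < c →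
      (s.info j).work = true → f ((s.advance v).solve j) = g ((s.advance v).solve j))
    (hact : gap σ s < c → f (G.act (actNode σ s) (due σ (actNode σ s))) =
      g (G.act (actNode σ s) (due σ (actNode σ s))))
    (hadv : c ≤ gap σ s → c < ⊤ → f (s.advance c.toNNReal) = g (s.advance c.toNNReal)) :
    G.next σ c f s = G.next σ c g s := by
  unfold next
  congr 1
  · refine Finset.sum_congr rfl fun j _ => ?_
    refine MeasureTheory.setLIntegral_congr_fun (measurableSet_window _) fun u hu => ?_
    by_cases hw : (s.info j).work = true
    · have h2 := lt_min_iff.1 hu.2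
      simp only [hsolve j u.toNNReal (by simpa using hu.1) h2.1 h2.2 hw]
    · simp [rate, hw]
  · split_ifs with h1 h2
    · rw [hact h1]
    · rw [hadv (not_lt.1 h1) h2]
    · rfl

variable {G}

lemma Calm.gap_eq {i : Fin N} {s : Node N} (h : G.Calm i s) (hc : ∀ j, G.Coherent s j)
    (τ : Strategy N) :
    gap (Function.update G.sigmaStar i τ) s = alarm τ (s.info i) - s.time := by
  rw [gap_of_forall_ne (i := i), Function.update_self]
  intro j hj
  rw [Function.update_of_ne hj]
  exact h.alarm_eq_top hj (hc j)

/-- While the opponents are calm, the next planned action is an action of `i`. -/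
lemma Calm.due_actNode {i : Fin N} {s : Node N} (h : G.Calm i s) (hc : ∀ j, G.Coherent s j)
    {τ : Strategy N} (hg : gap (Function.update G.sigmaStar i τ) s < ⊤) :
    due (Function.update G.sigmaStar i τ) (actNode (Function.update G.sigmaStar i τ) s) =
      Function.update (fun _ => none) i (some (τ (s.info i)).2) := by
  set σ := Function.update G.sigmaStar i τ with hσ
  have hinfo : (actNode σ s).info = s.info := rfl
  funext j
  by_cases hj : j = i
  · subst hj
    have hσj : σ j = τ := by simp [hσ]
    rw [due_eq_some, hσj, hinfo, Function.update_self]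
    rw [hσj, hinfo]
    have hg' := h.gap_eq hc τ
    rw [← hσ] at hg'
    rw [actNode, Node.advance_time, ENNReal.coe_add, ENNReal.coe_toNNReal hg.ne, hg']
    exact le_add_tsub
  · rw [Function.update_of_ne hj, hσ, due_update_of_ne _ _ _ hj]
    have hc' : G.Coherent (actNode σ s) j := by
      have := hc j
      exact ⟨this.pub_eq, this.pub_le, this.know_le, this.know_lt,
        this.last_le.trans (by simp [actNode])⟩
    exact (Calm.advance h _).due_eq_none hj hc'

/-- When an opponent has just solved a stage, she publishes it at once. -/
lemma Calm.due_solve {i j : Fin N} {x : Node N} (h : G.Calm i x) (hx : G.Reachable x)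
    (hj : j ≠ i) (hw : (x.info j).work = true) {τ : Strategy N}
    (hτ : (x.time : ℝ≥0∞) < alarm τ (x.info i)) :
    gap (Function.update G.sigmaStar i τ) (x.solve j) = 0 ∧
      due (Function.update G.sigmaStar i τ) (x.solve j) =
        Function.update (fun _ => none) j (some (Action.publish (x.pub + 1))) := by
  have hcx := hx.coherent
  have hc := (Reachable.solve x j hx hw).coherent
  have hσj : G.sigmaStar j ((x.solve j).info j) = (0, Action.publish (x.pub + 1)) := by
    rw [Node.solve_info_self, sigmaStar]
    simp [(hcx j).pub_eq, (h j hj).1]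
  have halarm : alarm (Function.update G.sigmaStar i τ j) ((x.solve j).info j) ≤
      (x.solve j).time := by
    rw [Function.update_of_ne hj, alarm, hσj, Node.solve_info_self]
    simp
  refine ⟨gap_eq_zero halarm, funext fun k => ?_⟩
  by_cases hkj : k = j
  · subst hkj
    rw [due_eq_some halarm, Function.update_of_ne hj, hσj]
    simp
  rw [Function.update_of_ne hkj]
  by_cases hki : k = i
  · subst hki
    refine TreasureHunt.due_eq_none ?_
    rw [Function.update_self, Node.solve_info_of_ne _ hkj]
    exact hτ
  · refine TreasureHunt.due_eq_none ?_
    rw [Function.update_of_ne hki, Node.solve_info_of_ne _ hkj, h.alarm_eq_top hki (hcx k)]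
    exact ENNReal.coe_lt_top

end Play

/-! ### Bayes' rule -/

section Bayes

variable {G : TreasureHunt N}

/-- Complying rivals publish nothing here, so `prepare` is the identity and `replayActs` recovers
`a`. -/
lemma replay_act {i : Fin N} {s : Node N} {a : Fin N → Option Action}
    (hs : s = G.wait i s.time (G.replay i (s.info i).record)) (hc : G.Compliant i s)
    (hcoh : ∀ j, G.Coherent s j) (ha : ∀ j, j ≠ i → a j = due G.sigmaStar s j)
    (hi : ¬ (a i = none ∧ s.nextPub a = s.pub)) :
    G.act s a = G.replay i ((G.act s a).info i).record := by
  rw [act_info_of_not G hi]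
  show _ = G.replayStep i ⟨s.time, false, a i, s.level a⟩ (G.wait i s.time _)
  rw [← hs]
  have hp : prepare i (s.level a) s = s :=
    Node.ext' rfl rfl fun j => prepare_info_of_le (level_le_know s a j)
  have hr : G.replayActs i ⟨s.time, false, a i, s.level a⟩ s = a := by
    funext j
    by_cases hj : j = i
    · subst hj; simp [replayActs]
    · have : s.level a j = 0 := level_eq_zero (by rw [ha j hj]; exact hc.due_eq hcoh j hj)
      simp [replayActs, hj, this, ha j hj]
  simp only [replayStep, Bool.false_eq_true, if_false, hp, hr]

lemma replay_solve {i : Fin N} {s : Node N}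
    (hs : s = G.wait i s.time (G.replay i (s.info i).record)) :
    s.solve i = G.replay i ((s.solve i).info i).record := by
  rw [Node.solve_info_self]
  show _ = G.replayStep i ⟨s.time, true, none, fun _ => 0⟩ (G.wait i s.time _)
  rw [← hs]
  simp [replayStep]

/-- The publisher was working on stage `x.pub`, so the invented discovery is exactly the `solve`
that took place. -/
lemma replay_publish {i j : Fin N} {x : Node N} (h : G.Calm i x) (hx : G.Reachable x)
    (hj : j ≠ i) (hw : (x.info j).work = true)
    (hs : x = G.wait i x.time (G.replay i (x.info i).record)) :
    G.act (x.solve j) (Function.update (fun _ => none) j (some (Action.publish (x.pub + 1)))) =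
      G.replay i ((G.act (x.solve j) (Function.update (fun _ => none) j
        (some (Action.publish (x.pub + 1))))).info i).record := by
  set a : Fin N → Option Action :=
    Function.update (fun _ => none) j (some (Action.publish (x.pub + 1))) with ha
  have haj : a j = some (Action.publish (x.pub + 1)) := by simp [ha]
  have hak : ∀ k, k ≠ j → a k = none := fun k hk => by simp [ha, hk]
  have hkn : ((x.solve j).info j).know = x.pub + 1 := by
    rw [Node.solve_info_self]; simp [(h j hj).1]
  have hlj : (x.solve j).level a j = x.pub + 1 := by
    rw [level_publish haj, hkn]; simp
  have hlk : ∀ k, k ≠ j → (x.solve j).level a k = 0 := fun k hk =>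
    level_eq_zero (Or.inl (hak k hk))
  have hnp : (x.solve j).nextPub a = x.pub + 1 := by
    rw [Node.nextPub, sup_level_of_forall_ne hlk, hlj]; simp
  have hi : ¬ (a i = none ∧ (x.solve j).nextPub a = (x.solve j).pub) := by
    rw [hnp]; simp
  rw [act_info_of_not G hi, Node.solve_info_of_ne x hj.symm]
  show _ = G.replayStep i ⟨x.time, false, a i, (x.solve j).level a⟩ (G.wait i x.time _)
  rw [← hs]
  have hp : prepare i ((x.solve j).level a) x = x.solve j := by
    refine Node.ext' rfl rfl fun k => ?_
    by_cases hk : k = j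
    · subst hk
      rw [Node.solve_info_self]
      simp [prepare, hj, hlj, (h k hj).1, learn, hw]
    · rw [prepare_info_of_le (by simp [hlk k hk]), Node.solve_info_of_ne x hk]
  have hr : G.replayActs i ⟨x.time, false, a i, (x.solve j).level a⟩ x = a := by
    funext k
    by_cases hki : k = i
    · subst hki; simp [replayActs]
    · by_cases hk : k = j
      · subst hk; simp [replayActs, hki, hlj, haj]
      · simp [replayActs, hki, hlk k hk, hak k hk, h.due_eq_none hki (hx.coherent k)]
  simp only [replayStep, Bool.false_eq_true, if_false, hp, hr]

/-- The opponents of `i` have settled since the last entry in her record. -/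
def Settled (G : TreasureHunt N) (i : Fin N) (s : Node N) : Prop :=
  (G.replay i (s.info i).record).time ≤ s.time ∧
    s = (G.settle i (G.replay i (s.info i).record)).advance
      (s.time - (G.replay i (s.info i).record).time)

lemma Settled.calm {i : Fin N} {s : Node N} (h : G.Settled i s) (hs : G.Reachable s) :
    G.Calm i s := by
  have he := (hs.explains i).1
  rw [h.2]
  exact settle_calm he.compliant he.coherent

/-- At the date of the last entry itself, `wait` returns the node before the rivals have settled;
hence the strict inequality. -/
lemma Settled.eq_wait {i : Fin N} {s : Node N} (h : G.Settled i s)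
    (hlt : (G.replay i (s.info i).record).time < s.time) :
    s = G.wait i s.time (G.replay i (s.info i).record) := by
  rw [wait_of_lt hlt]; exact h.2

lemma Settled.advance {i : Fin N} {s : Node N} (h : G.Settled i s) (v : ℝ≥0) :
    G.Settled i (s.advance v) := by
  refine ⟨h.1.trans (by simp), ?_⟩
  conv_lhs => rw [h.2]
  rw [Node.advance_advance, Node.advance_info, Node.advance_time, tsub_add_eq_add_tsub h.1]

/-- The nodes that can be reached from the nodes imagined by `i` when she uses `τ`, as long as she
has not been stopped at the moment when her record has had `n` entries for a time `u`. -/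
inductive OnTrack (G : TreasureHunt N) (i : Fin N) (τ : Strategy N) (n : ℕ) (u : ℝ≥0) :
    Node N → Prop
  | fresh (s : Node N) (hs : G.Reachable s) (h : s = G.replay i (s.info i).record) :
      OnTrack G i τ n u s
  | settled (s : Node N) (hs : G.Reachable s) (h : G.Settled i s)
      (hlt : (G.replay i (s.info i).record).time < s.time ∨
        (s.time : ℝ≥0∞) < alarm τ (s.info i) ∧ ((s.info i).record.length = n → u ≠ 0)) :
      OnTrack G i τ n u s
  | pending (s : Node N) (j : Fin N) (hs : G.Reachable s) (h : G.Settled i s)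
      (hlt : (G.replay i (s.info i).record).time < s.time)
      (hj : j ≠ i) (hw : (s.info j).work = true) (hτ : (s.time : ℝ≥0∞) < alarm τ (s.info i))
      (hn : (s.info i).record.length = n → s.time < (s.info i).last + u) :
      OnTrack G i τ n u (s.solve j)

variable {i : Fin N} {τ : Strategy N} {n : ℕ} {u : ℝ≥0} {c : ℝ≥0∞} {f g : Node N → ℝ≥0∞}

lemma next_congr_of_gap_eq_zero {σ : Fin N → Strategy N} {s : Node N} (hg : gap σ s = 0)
    (hc : 0 < c) (h : f (G.act s (due σ s)) = g (G.act s (due σ s))) :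
    G.next σ c f s = G.next σ c g s := by
  refine next_congr G (fun j v hv hlt => ?_) (fun _ => ?_) fun hle => ?_
  · rw [hg] at hlt; exact absurd hlt not_lt_zero
  · rw [actNode_of_gap_eq_zero hg]; exact h
  · rw [hg] at hle; exact absurd hle (not_le.2 hc)

/-- An event of `i` leads to a fresh node, a rival's solution to a pending one, and mere time to a
settled one. If no time has passed since her last entry, the second alternative of `hlt` puts her
next action at a strictly later date, where `replay` lets the rivals settle first. -/
lemma next_congr_settled (hfg : ∀ s, G.OnTrack i τ n u s → f s = g s) {s : Node N}
    (hs : G.Reachable s) (h : G.Settled i s)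
    (hlt : (G.replay i (s.info i).record).time < s.time ∨ (s.time : ℝ≥0∞) < alarm τ (s.info i))
    (hc : 0 < c)
    (hcn : (s.info i).record.length = n → (s.time : ℝ≥0∞) + c = ((s.info i).last + u : ℝ≥0)) :
    G.next (Function.update G.sigmaStar i τ) c f s =
      G.next (Function.update G.sigmaStar i τ) c g s := by
  set σ := Function.update G.sigmaStar i τ with hσ
  have hcalm := h.calm hs
  have hadv : ∀ v : ℝ≥0, 0 < v → (G.replay i ((s.advance v).info i).record).time <
      (s.advance v).time := fun v hv => lt_of_le_of_lt h.1 (by simpa using hv)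
  refine next_congr G (fun j v hv hvg hvc hw => hfg _ ?_) (fun hgc => hfg _ ?_)
    fun hcg hctop => hfg _ ?_
  · have hr : G.Reachable (s.advance v) := hs.advance s v
    by_cases hj : j = i
    · subst hj
      exact .fresh _ (hr.solve _ _ hw) (replay_solve ((h.advance v).eq_wait (hadv v hv)))
    · refine .pending (s.advance v) j hr (h.advance v) (hadv v hv) hj hw ?_ fun hn => ?_
      · have := lt_alarm_of_lt_gap hvg i
        rwa [hσ, Function.update_self] at this
      · have h1 : (s.time : ℝ≥0∞) + v < s.time + c :=
          ENNReal.add_lt_add_left ENNReal.coe_ne_top hvc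
        rw [hcn hn] at h1
        exact_mod_cast h1
  · have hgtop : gap σ s < ⊤ := hgc.trans_le le_top
    have hdue := hcalm.due_actNode hs.coherent hgtop
    rw [← hσ] at hdue
    have hr : G.Reachable (actNode σ s) := hs.advance s _
    have hlt' : (G.replay i ((actNode σ s).info i).record).time < (actNode σ s).time := by
      rcases hlt with hlt | hlt
      · exact lt_of_lt_of_le hlt (by simp [actNode])
      · refine hadv _ (ENNReal.toNNReal_pos ?_ hgtop.ne)
        rw [hσ, hcalm.gap_eq hs.coherent τ]
        exact (tsub_pos_iff_lt.2 hlt).ne'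
    refine .fresh _ (hr.act _ _) (replay_act ((h.advance _).eq_wait hlt')
      (Or.inl (hcalm.advance _)) hr.coherent (fun j hj => ?_) ?_)
    · rw [hσ, due_update_of_ne _ _ _ hj]
    · rw [hdue]; simp
  · refine .settled _ (hs.advance s _) (h.advance _) (Or.inl (hadv _ ?_))
    exact ENNReal.toNNReal_pos hc.ne' hctop.ne

/-- Rivals may be due at the date of the last entry. If `i` is not due as well, they settle without
a trace in her record. If she is, all act together, and her new entry makes `replay` repeat the
joint action. -/
lemma next_congr_fresh (hfg : ∀ s, G.OnTrack i τ n u s → f s = g s) {s : Node N}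
    (hs : G.Reachable s) (h : s = G.replay i (s.info i).record) (hc : 0 < c)
    (hcn : (s.info i).record.length = n → (s.time : ℝ≥0∞) + c = ((s.info i).last + u : ℝ≥0)) :
    G.next (Function.update G.sigmaStar i τ) c f s =
      G.next (Function.update G.sigmaStar i τ) c g s := by
  obtain ⟨hex, htime⟩ := hs.explains i
  rw [← h] at hex htime
  set σ := Function.update G.sigmaStar i τ with hσ
  have hset : (G.settle i s).info i = s.info i := settle_info_self hex.compliant hex.coherent
  by_cases hg : gap σ s = 0
  · refine next_congr_of_gap_eq_zero hg hc (hfg _ ?_)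
    by_cases hi : (s.time : ℝ≥0∞) < alarm τ (s.info i)
    · have hdue : due σ s = fun j => if j = i then none else due G.sigmaStar s j := by
        funext j
        split_ifs with hj
        · subst hj; exact due_eq_none (by rwa [hσ, Function.update_self])
        · rw [hσ, due_update_of_ne _ _ _ hj]
      rw [hdue]
      refine .settled (G.settle i s) (hs.settle i) ?_ (Or.inr ⟨?_, ?_⟩)
      · rw [Settled, hset, ← h]
        simp
      · rw [hset]; exact hi
      · rw [hset]
        -- With `u = 0` the evaluation takes place before the rivals settle, which contradicts `0 <
        -- c`.
        rintro hn rfl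
        have := hcn hn
        rw [htime, add_zero] at this
        exact hc.ne' ((ENNReal.add_right_inj ENNReal.coe_ne_top).1 (this.trans (add_zero _).symm))
    · have hdi : due σ s i = some (τ (s.info i)).2 := by
        rw [due_eq_some] <;> rw [hσ, Function.update_self]
        exact not_lt.1 hi
      refine .fresh _ (hs.act _ _) (replay_act ?_ hex.compliant hs.coherent (fun j hj => ?_) ?_)
      · rw [← h, wait_self]
      · rw [hσ, due_update_of_ne _ _ _ hj]
      · simp [hdi]
  · have hal := not_due_of_gap_ne_zero hg
    have hcalm : G.Calm i s := hex.compliant.calm_of_not_due hs.coherent fun j hj => by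
      rw [← due_update_of_ne G.sigmaStar τ s hj]; exact due_eq_none (hal j)
    refine next_congr_settled hfg hs ?_ (Or.inr ?_) hc hcn
    · rw [Settled, ← h, settle_of_calm hcalm hs.coherent]
      simp
    · have := hal i
      rwa [hσ, Function.update_self] at this

/-- Functions that agree at the nodes imagined by `i` have the same expectations at the moments
when `i` has a given number of entries in her record for a given time. -/
lemma reachUpTo_congr (hfg : ∀ s, s = G.wait i s.time (G.replay i (s.info i).record) → f s = g s)
    (k : ℕ) : ∀ s, G.OnTrack i τ n u s →
      G.reachUpTo (Function.update G.sigmaStar i τ) i n u f k s =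
        G.reachUpTo (Function.update G.sigmaStar i τ) i n u g k s := by
  induction k with
  | zero => intro s _; rfl
  | succ k ih =>
    have hcn : ∀ s : Node N, s.time < (s.info i).last + u →
        (s.time : ℝ≥0∞) + (((s.info i).last + u - s.time : ℝ≥0) : ℝ≥0∞) =
          ((s.info i).last + u : ℝ≥0) := fun s hlt => by
      rw [← ENNReal.coe_add, add_tsub_cancel_of_le hlt.le]
    have hpos : ∀ s : Node N, s.time < (s.info i).last + u →
        (0 : ℝ≥0∞) < (((s.info i).last + u - s.time : ℝ≥0) : ℝ≥0∞) := fun s hlt => by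
      exact_mod_cast tsub_pos_iff_lt.2 hlt
    intro s hs
    cases hs with
    | fresh _ hs h =>
      simp only [reachUpTo]
      split_ifs with h1 h2 h3
      · exact hfg s (by rw [← h, wait_self])
      · exact next_congr_fresh ih hs h (hpos s h3) fun _ => hcn s h3
      · rfl
      · exact next_congr_fresh ih hs h (by simp) fun hn => absurd hn h1
    | settled _ hs h hlt =>
      simp only [reachUpTo]
      split_ifs with h1 h2 h3
      · refine hfg s (h.eq_wait ?_)
        rcases hlt with hlt | hlt
        · exact hlt
        · rw [(hs.explains i).2, h2]
          exact lt_add_of_pos_right _ (pos_iff_ne_zero.2 (hlt.2 h1))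
      · exact next_congr_settled ih hs h (hlt.imp_right And.left) (hpos s h3) fun _ => hcn s h3
      · rfl
      · exact next_congr_settled ih hs h (hlt.imp_right And.left) (by simp) fun hn => absurd hn h1
    | pending x j hs h hlt hj hw hτ hn =>
      have hinfo : (x.solve j).info i = x.info i := Node.solve_info_of_ne x hj.symm
      have hcalm := h.calm hs
      have key : ∀ c : ℝ≥0∞, 0 < c →
          G.next (Function.update G.sigmaStar i τ) c
              (G.reachUpTo (Function.update G.sigmaStar i τ) i n u f k) (x.solve j) =
            G.next (Function.update G.sigmaStar i τ) c
              (G.reachUpTo (Function.update G.sigmaStar i τ) i n u g k) (x.solve j) := by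
        intro c hc
        obtain ⟨hg, hdue⟩ := hcalm.due_solve hs hj hw hτ
        refine next_congr_of_gap_eq_zero hg hc (ih _ ?_)
        rw [hdue]
        exact .fresh _ ((Reachable.solve x j hs hw).act _ _)
          (replay_publish hcalm hs hj hw (h.eq_wait hlt))
      simp only [reachUpTo]
      rw [hinfo, Node.solve_time]
      split_ifs with h1 h2 h3
      -- At this instant the actual node is ahead of the imagined one, but the evaluation date is
      -- strictly later.
      · exact absurd h2 (hn h1).ne
      · exact key _ (hpos x h3)
      · rfl
      · exact key _ (by simp)

end Bayes

/-! ### Measurability -/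

section Measurability

lemma measurable_info_pub : Measurable (Info.pub (N := N)) :=
  measurable_iff_comap_le.2 (le_sup_of_le_left (le_sup_of_le_left (le_sup_of_le_left le_sup_left)))

lemma measurable_info_know : Measurable (Info.know (N := N)) :=
  measurable_iff_comap_le.2
    (le_sup_of_le_left (le_sup_of_le_left (le_sup_of_le_left le_sup_right)))

lemma measurable_info_work : Measurable (Info.work (N := N)) :=
  measurable_iff_comap_le.2 (le_sup_of_le_left (le_sup_of_le_left le_sup_right))

lemma measurable_info_last : Measurable (Info.last (N := N)) :=
  measurable_iff_comap_le.2 (le_sup_of_le_left le_sup_right)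

lemma measurable_info_record :
    Measurable fun I : Info N => List.equivSigmaTuple I.record :=
  measurable_iff_comap_le.2 le_sup_right

lemma measurable_entry_time : Measurable (Entry.time (N := N)) :=
  measurable_iff_comap_le.2 (le_sup_of_le_left (le_sup_of_le_left le_sup_left))

lemma measurable_entry_solved : Measurable (Entry.solved (N := N)) :=
  measurable_iff_comap_le.2 (le_sup_of_le_left (le_sup_of_le_left le_sup_right))

open MeasureTheory in
lemma measurable_entry_act : Measurable[_, ⊤] (Entry.act (N := N)) :=
  measurable_iff_comap_le.2 (le_sup_of_le_left le_sup_right)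

open MeasureTheory in
lemma measurable_entry_pubs : Measurable[_, ⊤] (Entry.pubs (N := N)) :=
  measurable_iff_comap_le.2 le_sup_right

lemma measurable_node_time : Measurable (Node.time (N := N)) :=
  measurable_iff_comap_le.2 (le_sup_of_le_left le_sup_left)

lemma measurable_node_pub : Measurable (Node.pub (N := N)) :=
  measurable_iff_comap_le.2 (le_sup_of_le_left le_sup_right)

lemma measurable_node_info : Measurable (Node.info (N := N)) :=
  measurable_iff_comap_le.2 le_sup_right

/-- Once singletons of `Node` are measurable, an integral against a point mass is the value at the
point for every function, and the mass is full on every set that contains the point. Neither payoffs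
nor information sets have to be shown measurable. -/
instance : MeasurableSingletonClass (Entry N) where
  measurableSet_singleton e := by
    have h : ({e} : Set (Entry N)) = Entry.time ⁻¹' {e.time} ∩ Entry.solved ⁻¹' {e.solved} ∩
        Entry.act ⁻¹' {e.act} ∩ Entry.pubs ⁻¹' {e.pubs} := by
      ext e'
      cases e; cases e'
      simp [and_assoc]
    rw [h]
    exact (((measurable_entry_time (measurableSet_singleton _)).inter
      (measurable_entry_solved (measurableSet_singleton _))).inter
      (measurable_entry_act MeasurableSpace.measurableSet_top)).inter
      (measurable_entry_pubs MeasurableSpace.measurableSet_top)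

lemma measurableSet_singleton_sigma {ι : Type*} {β : ι → Type*} [∀ a, MeasurableSpace (β a)]
    [∀ a, MeasurableSingletonClass (β a)] (y : Σ a, β a) :
    MeasurableSet ({y} : Set (Σ a, β a)) := by
  refine MeasurableSpace.measurableSet_iInf.2 fun a => ?_
  show MeasurableSet (Sigma.mk a ⁻¹' {y})
  refine Set.Subsingleton.measurableSet fun z hz w hw => ?_
  have : (⟨a, z⟩ : Σ a, β a) = ⟨a, w⟩ := (Set.mem_singleton_iff.1 hz).trans
    (Set.mem_singleton_iff.1 hw).symm
  simpa using this

instance : MeasurableSingletonClass (Info N) where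
  measurableSet_singleton I := by
    have h : ({I} : Set (Info N)) = Info.pub ⁻¹' {I.pub} ∩ Info.know ⁻¹' {I.know} ∩
        Info.work ⁻¹' {I.work} ∩ Info.last ⁻¹' {I.last} ∩
        (fun I : Info N => List.equivSigmaTuple I.record) ⁻¹' {List.equivSigmaTuple I.record} := by
      ext I'
      simp only [Set.mem_singleton_iff, Set.mem_inter_iff, Set.mem_preimage,
        EmbeddingLike.apply_eq_iff_eq]
      cases I; cases I'
      simp [and_assoc]
    rw [h]
    exact ((((measurable_info_pub (measurableSet_singleton _)).inter
      (measurable_info_know (measurableSet_singleton _))).inter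
      (measurable_info_work (measurableSet_singleton _))).inter
      (measurable_info_last (measurableSet_singleton _))).inter
      (measurable_info_record (measurableSet_singleton_sigma _))

instance : MeasurableSingletonClass (Node N) where
  measurableSet_singleton s := by
    have h : ({s} : Set (Node N)) = Node.time ⁻¹' {s.time} ∩ Node.pub ⁻¹' {s.pub} ∩
        Node.info ⁻¹' {s.info} := by
      ext s'
      cases s; cases s'
      simp [and_assoc]
    rw [h]
    exact ((measurable_node_time (measurableSet_singleton _)).inter
      (measurable_node_pub (measurableSet_singleton _))).inter
      (measurable_node_info (measurableSet_singleton _))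

lemma measurable_sigmaStar (G : TreasureHunt N) (i : Fin N) : Measurable (G.sigmaStar i) := by
  classical
  have h : G.sigmaStar i = (fun q : ℕ × ℕ × Bool =>
      if q.1 < q.2.1 then ((0 : ℝ≥0∞), Action.publish q.2.1)
      else if q.2.2 = false ∧ q.2.1 < G.M ∧ i ∈ G.Istar q.2.1 then (0, Action.enter)
      else (⊤, Action.enter)) ∘ fun I => (I.pub, I.know, I.work) := rfl
  rw [h]
  exact Measurable.of_discrete.comp
    (measurable_info_pub.prodMk (measurable_info_know.prodMk measurable_info_work))

end Measurability

/-! ### The beliefs -/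

section Beliefs

variable (G : TreasureHunt N)

/-- The node that `i` imagines at date `t` when her information is `I`. -/
noncomputable def imagined (i : Fin N) (I : Info N) (t : ℝ≥0) : Node N :=
  G.wait i t (G.replay i I.record)

/-- Every scientist is sure that the node is the one that she imagines. -/
noncomputable def beliefs : Beliefs N := fun i I t => MeasureTheory.Measure.dirac (G.imagined i I t)

variable {G}

lemma imagined_explains {i : Fin N} {I : Info N} {t : ℝ≥0} (h : (G.InfoSet i I t).Nonempty) :
    ∃ m, G.Explains i (G.imagined i I t) I m ∧ (G.imagined i I t).time = t := by
  obtain ⟨s, hs, rfl, rfl⟩ := h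
  obtain ⟨h1, h2⟩ := hs.explains i
  exact ⟨s.pub, h1.wait _, wait_time (by rw [h2]; exact (hs.coherent i).last_le)⟩

lemma imagined_mem {i : Fin N} {I : Info N} {t : ℝ≥0} (h : (G.InfoSet i I t).Nonempty) :
    G.imagined i I t ∈ G.InfoSet i I t := by
  obtain ⟨m, h1, h2⟩ := imagined_explains h
  exact ⟨h1.reachable, h2, h1.info_eq⟩

lemma onTrack_imagined {i : Fin N} {I : Info N} {t : ℝ≥0} (h : (G.InfoSet i I t).Nonempty)
    (τ : Strategy N) (n : ℕ) (u : ℝ≥0) : G.OnTrack i τ n u (G.imagined i I t) := by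
  obtain ⟨hr, ht, hI⟩ := imagined_mem h
  obtain ⟨s, hs, rfl, rfl⟩ := h
  obtain ⟨h1, h2⟩ := hs.explains i
  have hle : (G.replay i (s.info i).record).time ≤ s.time := by
    rw [h2]; exact (hs.coherent i).last_le
  rcases hle.eq_or_lt with heq | hlt
  · refine .fresh _ hr ?_
    rw [hI, imagined, ← heq, wait_self]
  · refine .settled _ hr ?_ (Or.inl ?_)
    · rw [Settled, hI, ht]
      exact ⟨hle, wait_of_lt hlt⟩
    · rw [hI, ht]; exact hlt

/-- Under a point belief the inner integral is `f` at the imagined node, so both sides of Bayes'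
rule agree once the evaluated nodes are the imagined ones. -/
lemma bayesRule_dirac {i : Fin N} {s : Node N} {τ : Strategy N}
    (h : ∀ n u, G.OnTrack i τ n u s) :
    G.BayesRule (Function.update G.sigmaStar i τ) G.beliefs i (MeasureTheory.Measure.dirac s) := by
  intro n u f φ hf _
  simp only [reach, MeasureTheory.lintegral_dirac]
  refine iSup_congr fun k => reachUpTo_congr (fun s hs => ?_) k s (h n u)
  rw [beliefs, MeasureTheory.lintegral_dirac, imagined, ← hs]

end Beliefs

/-! ### The continuation values -/

section Values

variable (G : TreasureHunt N)

/-- The assumptions on the primitives under which public sharing is an equilibrium. -/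
structure Admissible : Prop where
  h_pos : ∀ i, 0 < G.h i
  h_anti : StrictAnti G.h
  x_nonneg : 0 ≤ G.x
  V_pos : ∀ m < G.M, 0 < G.V m
  d_pos : ∀ m < G.M, 0 < G.d m
  F_pos : ∀ m < G.M, 0 < G.F m
  F_lt : ∀ m < G.M, G.F m < G.netValue m
  sharing : ∀ m m', m < m' → m' < G.M → ∀ i, 0 ≤ G.V m * G.rivals m i / G.d m -
    G.h i / G.d m' *
      ((G.V m' * G.rivals m' i + G.x * G.d m' * G.h i) / (G.h i + G.rivals m' i))

/-- Expected gain of `i` from stage `m`, once she works on it. -/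
noncomputable def workValue (i : Fin N) (m : ℕ) : ℝ :=
  G.netValue m * G.h i / (G.h i + G.rivals m i)

/-- Expected gain of `i` from the stages from `k` on, before she starts to work on stage `k`. -/
noncomputable def idleValue (i : Fin N) (k : ℕ) : ℝ :=
  ∑ l ∈ Finset.Ico k G.M, max 0 (G.workValue i l - G.F l)

/-- Continuation value of `i` when `m` stages are published, `i` has solved `k` stages, and works
on the next one iff `w = true`. -/
noncomputable def contValue (i : Fin N) (m k : ℕ) (w : Bool) : ℝ :=
  ∑ l ∈ Finset.Ico m k, G.V l +
    if w = true then G.idleValue i (k + 1) + G.workValue i k else G.idleValue i k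

/-- Continuation value of `i` after an opponent has published stage `m`. -/
noncomputable def rivalValue (i : Fin N) (m k : ℕ) (w : Bool) : ℝ :=
  G.contValue i (m + 1) (max k (m + 1)) (w && decide (m + 1 ≤ k))

variable {G}

lemma Admissible.rivals_nonneg (hG : G.Admissible) (m : ℕ) (i : Fin N) : 0 ≤ G.rivals m i :=
  capital_nonneg hG.h_pos _

/-- For a member, `h i + rivals` is the capital of `Istar m`; for an outsider it is the capital
after she joins. In both cases `workValue - F` is a payoff of the participation game, and its sign
is an equilibrium condition. -/
lemma Admissible.workValue_sub_of_mem (hG : G.Admissible)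
    {i : Fin N} {m : ℕ} (hm : m < G.M) (hi : i ∈ G.Istar m) :
    0 ≤ G.workValue i m - G.F m := by
  have h := (isStageEquilibrium_Istar hG.h_pos hG.h_anti (hG.F_pos m hm) (hG.F_lt m hm)).1 i hi
  rw [stagePayoff_eq] at h
  rwa [workValue, rivals, show G.h i + G.capital ((G.Istar m).erase i) = G.capital (G.Istar m) from
    Finset.add_sum_erase _ _ hi]

lemma Admissible.workValue_sub_of_notMem (hG : G.Admissible) {i : Fin N} {m : ℕ} (hm : m < G.M)
    (hi : i ∉ G.Istar m) : G.workValue i m - G.F m ≤ 0 := by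
  have h := (isStageEquilibrium_Istar hG.h_pos hG.h_anti (hG.F_pos m hm) (hG.F_lt m hm)).2 i hi
  rw [stagePayoff_eq, capital_insert hi] at h
  rwa [workValue, rivals, Finset.erase_eq_of_notMem hi]

lemma Admissible.workValue_nonneg (hG : G.Admissible)
    (i : Fin N) {m : ℕ} (hm : m < G.M) : 0 ≤ G.workValue i m := by
  have h1 := hG.h_pos i
  have h2 := hG.rivals_nonneg m i
  have h3 := (hG.F_pos m hm).trans (hG.F_lt m hm)
  unfold workValue
  positivity

lemma idleValue_nonneg (i : Fin N) (k : ℕ) : 0 ≤ G.idleValue i k :=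
  Finset.sum_nonneg fun _ _ => le_max_left _ _

lemma idleValue_succ (i : Fin N) {k : ℕ} (hk : k < G.M) :
    G.idleValue i k = max 0 (G.workValue i k - G.F k) + G.idleValue i (k + 1) :=
  Finset.sum_eq_sum_Ico_succ_bot hk _

lemma Admissible.sum_V_nonneg (hG : G.Admissible)
    {m k : ℕ} (hk : k ≤ G.M) : 0 ≤ ∑ l ∈ Finset.Ico m k, G.V l :=
  Finset.sum_nonneg fun l hl => (hG.V_pos l ((Finset.mem_Ico.1 hl).2.trans_le hk)).le

lemma Admissible.contValue_nonneg (hG : G.Admissible)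
    (i : Fin N) {m k : ℕ} {w : Bool} (hk : k ≤ G.M)
    (hw : w = true → k < G.M) : 0 ≤ G.contValue i m k w := by
  refine add_nonneg (hG.sum_V_nonneg hk) ?_
  split_ifs with h
  · exact add_nonneg (idleValue_nonneg i _) (hG.workValue_nonneg i (hw h))
  · exact idleValue_nonneg i _

lemma contValue_publish (i : Fin N) {m r k : ℕ} (w : Bool) (hmr : m ≤ r) (hrk : r ≤ k) :
    ∑ l ∈ Finset.Ico m r, G.V l + G.contValue i r k w = G.contValue i m k w := by
  rw [contValue, contValue, ← Finset.sum_Ico_consecutive _ hmr hrk, add_assoc]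

/-- The fixed cost is sunk: quitting forfeits a nonnegative `workValue`, and coming back costs `F k`
again. -/
lemma Admissible.contValue_quit (hG : G.Admissible) (i : Fin N) (m : ℕ) {k : ℕ} (hk : k < G.M) :
    G.contValue i m k false ≤ G.contValue i m k true := by
  have h1 := hG.workValue_nonneg i hk
  have h2 := hG.F_pos k hk
  simp only [contValue, Bool.false_eq_true, if_false, if_true, idleValue_succ i hk]
  have : max 0 (G.workValue i k - G.F k) ≤ G.workValue i k := max_le h1 (by linarith)
  linarith

lemma contValue_enter (i : Fin N) (m : ℕ) {k : ℕ} (hk : k < G.M) :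
    G.contValue i m k true ≤ G.F k + G.contValue i m k false := by
  simp only [contValue, Bool.false_eq_true, if_false, if_true, idleValue_succ i hk]
  have := le_max_right 0 (G.workValue i k - G.F k)
  linarith

lemma Admissible.contValue_enter_of_mem (hG : G.Admissible)
    {i : Fin N} (m : ℕ) {k : ℕ} (hk : k < G.M)
    (hi : i ∈ G.Istar k) : G.F k + G.contValue i m k false = G.contValue i m k true := by
  simp only [contValue, Bool.false_eq_true, if_false, if_true, idleValue_succ i hk,
    max_eq_right (hG.workValue_sub_of_mem hk hi)]
  ring

lemma Admissible.rivalValue_nonneg (hG : G.Admissible)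
    (i : Fin N) {m k : ℕ} {w : Bool} (hm : m < G.M) (hk : k ≤ G.M)
    (hw : w = true → k < G.M) : 0 ≤ G.rivalValue i m k w := by
  refine hG.contValue_nonneg i (max_le hk hm) fun h => ?_
  rw [Bool.and_eq_true, decide_eq_true_eq] at h
  rw [max_eq_left h.2]
  exact hw h.1

/-- When `i` already has stage `m`, a rival's publication deprives her of that credit and changes
nothing else. -/
lemma rivalValue_of_lt (i : Fin N) {m k : ℕ} (w : Bool) (hmk : m < k) :
    G.V m + G.rivalValue i m k w = G.contValue i m k w := by
  rw [rivalValue, max_eq_left hmk, decide_eq_true (Nat.succ_le_of_lt hmk), Bool.and_true,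
    ← contValue_publish i w (Nat.le_succ m) hmk]
  simp

lemma rivalValue_self (i : Fin N) (m : ℕ) (w : Bool) :
    G.rivalValue i m m w = G.idleValue i (m + 1) := by
  simp [rivalValue, contValue]

lemma contValue_self (i : Fin N) (m : ℕ) (w : Bool) : G.contValue i m m w =
    if w = true then G.idleValue i (m + 1) + G.workValue i m else G.idleValue i m := by
  simp [contValue]

lemma contValue_solved (i : Fin N) {m k : ℕ} (hmk : m ≤ k) :
    G.contValue i m (k + 1) false - G.contValue i m k true = G.V k - G.workValue i k := by
  simp only [contValue, Bool.false_eq_true, if_false, if_true, Finset.sum_Ico_succ_top hmk]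
  ring

/-- While `i` works on the first unpublished stage, her value is constant on average. -/
lemma Admissible.work_balance (hG : G.Admissible) (i : Fin N) {m : ℕ} (hm : m < G.M) :
    G.h i / G.d m * (G.V m - G.workValue i m) =
      G.rivals m i / G.d m * G.workValue i m + G.h i * G.x := by
  have h1 := hG.h_pos i
  have h2 := hG.rivals_nonneg m i
  have h3 := hG.d_pos m hm
  have h4 : G.h i + G.rivals m i ≠ 0 := by positivity
  unfold workValue netValue
  field_simp
  ring

/-- The continuation value does not increase on average while time passes. -/
lemma Admissible.drift_le (hG : G.Admissible)
    (i : Fin N) {m k : ℕ} {w : Bool} (hm : m < G.M) (hmk : m ≤ k)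
    (hw : w = true → k < G.M) :
    G.rivals m i / G.d m * G.rivalValue i m k w +
        (if w = true then G.h i / G.d k else 0) * G.contValue i m (k + 1) false ≤
      (G.rivals m i / G.d m + if w = true then G.h i / G.d k else 0) * G.contValue i m k w +
        if w = true then G.h i * G.x else 0 := by
  have hR : 0 ≤ G.rivals m i / G.d m := div_nonneg (hG.rivals_nonneg m i) (hG.d_pos m hm).le
  rcases hmk.eq_or_lt with rfl | hlt
  · rw [rivalValue_self]
    cases w with
    | false =>
      have : G.idleValue i (m + 1) ≤ G.idleValue i m := by
        rw [idleValue_succ i hm]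
        linarith [le_max_left 0 (G.workValue i m - G.F m)]
      simp only [contValue_self, Bool.false_eq_true, if_false]
      nlinarith
    | true =>
      have h1 := contValue_solved (G := G) i (le_refl m)
      have h2 := hG.work_balance i hm
      have h3 := contValue_self (G := G) i m true
      simp only [if_true] at h3 ⊢
      have h4 : G.contValue i m (m + 1) false =
          G.V m - G.workValue i m + G.contValue i m m true := by
        linarith
      rw [h4, h3]
      linarith
  · have h1 := rivalValue_of_lt (G := G) i w hlt
    have h2 : G.rivalValue i m k w = G.contValue i m k w - G.V m := by linarith
    rw [h2]
    cases w with
    | false =>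
      have := mul_nonneg hR (hG.V_pos m hm).le
      simp only [Bool.false_eq_true, if_false]
      linarith
    | true =>
      have hk := hw rfl
      have h3 := contValue_solved (G := G) i hmk
      have h4 : G.contValue i m (k + 1) false =
          G.V k - G.workValue i k + G.contValue i m k true := by
        linarith
      -- The rate at which hidden credit for `m` is lost exceeds the rate of gain from working ahead
      -- on `k`, even before her opportunity cost is counted.
      have h5 := hG.sharing m k hlt hk i
      have h6 : G.V k - G.workValue i k =
          (G.V k * G.rivals k i + G.x * G.d k * G.h i) / (G.h i + G.rivals k i) := by
        have h1 := hG.h_pos i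
        have h2 := hG.rivals_nonneg k i
        have h4 : G.h i + G.rivals k i ≠ 0 := by positivity
        unfold workValue netValue
        field_simp
        ring
      have h7 := mul_nonneg (hG.h_pos i).le hG.x_nonneg
      rw [← h6] at h5
      simp only [if_true, h4]
      have h8 : G.V m * G.rivals m i / G.d m = G.rivals m i / G.d m * G.V m := by ring
      linarith

/-- While `i` waits as prescribed by `σ*`, her value is constant on average. -/
lemma Admissible.drift_eq (hG : G.Admissible) (i : Fin N) {m : ℕ} {w : Bool} (hm : m < G.M)
    (hw : w = true ∨ i ∉ G.Istar m) :
    G.rivals m i / G.d m * G.rivalValue i m m w +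
        (if w = true then G.h i / G.d m else 0) * G.contValue i m (m + 1) false =
      (G.rivals m i / G.d m + if w = true then G.h i / G.d m else 0) * G.contValue i m m w +
        if w = true then G.h i * G.x else 0 := by
  rw [rivalValue_self]
  cases w with
  | false =>
    have hi : i ∉ G.Istar m := by simpa using hw
    rw [contValue_self]
    simp only [Bool.false_eq_true, if_false, idleValue_succ i hm,
      max_eq_left (hG.workValue_sub_of_notMem hm hi)]
    ring
  | true =>
    have h1 := contValue_solved (G := G) i (le_refl m)
    have h2 := hG.work_balance i hm
    have h3 := contValue_self (G := G) i m true
    simp only [if_true] at h3 ⊢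
    have h4 : G.contValue i m (m + 1) false = G.V m - G.workValue i m + G.contValue i m m true := by
      linarith
    rw [h4, h3]
    linarith

end Values

/-! ### Expectations over the next event -/

section NextEvent

open MeasureTheory in
lemma lintegral_exp_tail {r : ℝ} (hr : 0 < r) (c : ℝ) :
    ∫⁻ u in Set.Ioi c, ENNReal.ofReal (r * Real.exp (-(r * u))) =
      ENNReal.ofReal (Real.exp (-(r * c))) := by
  have h1 := integrableOn_exp_mul_Ioi (neg_lt_zero.2 hr) c
  have h2 := integral_exp_mul_Ioi (neg_lt_zero.2 hr) c
  simp only [neg_mul] at h1 h2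
  rw [← ofReal_integral_eq_lintegral_ofReal (h1.const_mul r)
    (Filter.Eventually.of_forall fun u => by positivity), integral_const_mul, h2]
  congr 1
  field_simp

open MeasureTheory in
lemma lintegral_exp_window {r : ℝ} (hr : 0 < r) (g : ℝ≥0) :
    (∫⁻ u in {u : ℝ | 0 < u ∧ ENNReal.ofReal u < g}, ENNReal.ofReal (r * Real.exp (-(r * u)))) +
      ENNReal.ofReal (Real.exp (-(r * g))) = 1 := by
  have hset : {u : ℝ | 0 < u ∧ ENNReal.ofReal u < g} = Set.Ioo 0 (g : ℝ) := by
    ext u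
    refine and_congr_right fun hu => ?_
    rw [← ENNReal.ofReal_coe_nnreal, ENNReal.ofReal_lt_ofReal_iff_of_nonneg hu.le]
  have hsplit : Set.Ioc 0 (g : ℝ) ∪ Set.Ioi (g : ℝ) = Set.Ioi 0 :=
    Set.Ioc_union_Ioi_eq_Ioi g.2
  rw [hset, setLIntegral_congr Ioo_ae_eq_Ioc, ← lintegral_exp_tail hr,
    ← lintegral_union measurableSet_Ioi (Set.Ioc_disjoint_Ioi le_rfl), hsplit,
    lintegral_exp_tail hr]
  simp

variable (G : TreasureHunt N)

/-- The waiting time for a solution is exponential, so the rate times the expected time until the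
next event is the probability that a solution comes first. -/
lemma ofReal_totalRate_mul_expectedTime (σ : Fin N → Strategy N) {s : Node N}
    (hr : 0 < G.totalRate s) :
    ENNReal.ofReal (G.totalRate s) * G.expectedTime σ s + actProb G σ s = 1 := by
  have h1 : ENNReal.ofReal (G.totalRate s) * G.expectedTime σ s =
      ∫⁻ u in {u : ℝ | 0 < u ∧ ENNReal.ofReal u < gap σ s},
        ENNReal.ofReal (G.totalRate s * Real.exp (-(G.totalRate s * u))) := by
    rw [expectedTime, ← MeasureTheory.lintegral_const_mul' _ _ ENNReal.ofReal_ne_top]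
    simp only [ENNReal.ofReal_mul hr.le, silence]
  rw [h1, actProb]
  generalize gap σ s = g
  induction g using ENNReal.recTopCoe with
  | top =>
    have : {u : ℝ | 0 < u ∧ ENNReal.ofReal u < ⊤} = Set.Ioi 0 := by ext u; simp
    rw [this, lintegral_exp_tail hr]
    simp
  | coe g =>
    rw [if_pos ENNReal.coe_lt_top]
    exact lintegral_exp_window hr g

lemma ofReal_totalRate_mul_expectedTime_le (σ : Fin N → Strategy N) {s : Node N}
    (hr : 0 ≤ G.totalRate s) :
    ENNReal.ofReal (G.totalRate s) * G.expectedTime σ s + actProb G σ s ≤ 1 := by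
  -- At total rate zero the expected time may be infinite; the product is still `0`.
  rcases hr.eq_or_lt with h | h
  · rw [← h, actProb]
    split_ifs <;> simp [silence, ← h]
  · exact (ofReal_totalRate_mul_expectedTime G σ h).le

variable {G}

/-- The expectation of `g` at the next node plus a constant for every kind of event. -/
lemma next_add_const {σ : Fin N → Strategy N} (g : Node N → ℝ≥0∞) {s : Node N}
    (hr : ∀ j, 0 ≤ G.rate s j) (K : Fin N → ℝ≥0∞) (K' : ℝ≥0∞) :
    G.next σ ⊤ g s + ((∑ j, ENNReal.ofReal (G.rate s j) * K j) * G.expectedTime σ s +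
        actProb G σ s * K') =
      (∑ j, ∫⁻ u in {u : ℝ | 0 < u ∧ ENNReal.ofReal u < gap σ s},
        ENNReal.ofReal (G.rate s j * G.silence s u) *
          (g ((s.advance u.toNNReal).solve j) + K j)) +
      if gap σ s < ⊤ then ENNReal.ofReal (G.silence s (gap σ s).toReal) *
        (g (G.act (actNode σ s) (due σ (actNode σ s))) + K') else 0 := by
  have hm : ∀ j, Measurable fun u : ℝ => ENNReal.ofReal (G.rate s j * G.silence s u) := by
    intro j; unfold silence; fun_prop
  have h1 : ∀ j, ∫⁻ u in {u : ℝ | 0 < u ∧ ENNReal.ofReal u < gap σ s},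
        ENNReal.ofReal (G.rate s j * G.silence s u) *
          (g ((s.advance u.toNNReal).solve j) + K j) =
      (∫⁻ u in {u : ℝ | 0 < u ∧ ENNReal.ofReal u < gap σ s},
        ENNReal.ofReal (G.rate s j * G.silence s u) * g ((s.advance u.toNNReal).solve j)) +
      ENNReal.ofReal (G.rate s j) * K j * G.expectedTime σ s := by
    intro j
    simp only [mul_add]
    -- Only the constant summand has to be measurable, so `g` may be arbitrary.
    rw [MeasureTheory.lintegral_add_right _ ((hm j).mul_const _),
      MeasureTheory.lintegral_mul_const _ (hm j), expectedTime]
    simp only [ENNReal.ofReal_mul (hr j)]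
    rw [MeasureTheory.lintegral_const_mul' _ _ ENNReal.ofReal_ne_top]
    ring
  simp only [h1, Finset.sum_add_distrib, Finset.sum_mul, next, min_top_right, lt_irrefl, if_false,
    actProb]
  split_ifs
  · ring
  · ring

lemma next_le_add {σ : Fin N → Strategy N} {f g : Node N → ℝ≥0∞} {s : Node N}
    (hr : ∀ j, 0 ≤ G.rate s j) {K : Fin N → ℝ≥0∞} {K' : ℝ≥0∞}
    (hsolve : ∀ j (v : ℝ≥0), 0 < v → (v : ℝ≥0∞) < gap σ s → (s.info j).work = true →
      f ((s.advance v).solve j) ≤ g ((s.advance v).solve j) + K j)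
    (hact : gap σ s < ⊤ → f (G.act (actNode σ s) (due σ (actNode σ s))) ≤
      g (G.act (actNode σ s) (due σ (actNode σ s))) + K') :
    G.next σ ⊤ f s ≤ G.next σ ⊤ g s +
      ((∑ j, ENNReal.ofReal (G.rate s j) * K j) * G.expectedTime σ s + actProb G σ s * K') := by
  rw [next_add_const g hr]
  simp only [next, min_top_right, lt_irrefl, if_false]
  refine add_le_add (Finset.sum_le_sum fun j _ => ?_) ?_
  · refine MeasureTheory.setLIntegral_mono' (measurableSet_window _) fun u hu => ?_
    by_cases hw : (s.info j).work = true
    · exact mul_le_mul_right (hsolve j u.toNNReal (by simpa using hu.1) hu.2 hw) _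
    · simp [rate, hw]
  · split_ifs with h
    · exact mul_le_mul_right (hact h) _
    · exact le_rfl

lemma add_le_next {σ : Fin N → Strategy N} {f g : Node N → ℝ≥0∞} {s : Node N}
    (hr : ∀ j, 0 ≤ G.rate s j) {K : Fin N → ℝ≥0∞} {K' : ℝ≥0∞}
    (hsolve : ∀ j (v : ℝ≥0), 0 < v → (v : ℝ≥0∞) < gap σ s → (s.info j).work = true →
      g ((s.advance v).solve j) + K j ≤ f ((s.advance v).solve j))
    (hact : gap σ s < ⊤ → g (G.act (actNode σ s) (due σ (actNode σ s))) + K' ≤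
      f (G.act (actNode σ s) (due σ (actNode σ s)))) :
    G.next σ ⊤ g s +
      ((∑ j, ENNReal.ofReal (G.rate s j) * K j) * G.expectedTime σ s + actProb G σ s * K') ≤
      G.next σ ⊤ f s := by
  rw [next_add_const g hr]
  simp only [next, min_top_right, lt_irrefl, if_false]
  refine add_le_add (Finset.sum_le_sum fun j _ => ?_) ?_
  · refine MeasureTheory.setLIntegral_mono' (measurableSet_window _) fun u hu => ?_
    by_cases hw : (s.info j).work = true
    · exact mul_le_mul_right (hsolve j u.toNNReal (by simpa using hu.1) hu.2 hw) _
    · simp [rate, hw]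
  · split_ifs with h
    · exact mul_le_mul_right (hact h) _
    · exact le_rfl

lemma next_mono {σ : Fin N → Strategy N} {f g : Node N → ℝ≥0∞} (hfg : ∀ s, f s ≤ g s)
    (s : Node N) : G.next σ ⊤ f s ≤ G.next σ ⊤ g s := by
  unfold next
  refine add_le_add (Finset.sum_le_sum fun j _ => MeasureTheory.lintegral_mono fun u =>
    mul_le_mul_right (hfg _) _) ?_
  split_ifs
  · exact mul_le_mul_right (hfg _) _
  · exact mul_le_mul_right (hfg _) _
  · exact le_rfl

lemma window_eq_empty {g : ℝ≥0∞} (hg : g = 0) : {u : ℝ | 0 < u ∧ ENNReal.ofReal u < g} = ∅ := by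
  simp [hg]

lemma next_of_gap_eq_zero {σ : Fin N → Strategy N} (f : Node N → ℝ≥0∞) {s : Node N}
    (hg : gap σ s = 0) : G.next σ ⊤ f s = f (G.act s (due σ s)) := by
  rw [next, min_top_right, window_eq_empty hg, hg, actNode_of_gap_eq_zero hg]
  simp [silence]

lemma actProb_of_gap_eq_zero {σ : Fin N → Strategy N} {s : Node N} (hg : gap σ s = 0) :
    actProb G σ s = 1 := by
  simp [actProb, hg, silence]

lemma rewardUpTo_of_gap_eq_zero {σ : Fin N → Strategy N} {s : Node N} (hg : gap σ s = 0)
    (i : Fin N) (n : ℕ) : G.rewardUpTo σ i (n + 1) s =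
      ENNReal.ofReal (G.credit s (due σ s) i) + G.rewardUpTo σ i n (G.act s (due σ s)) := by
  rw [rewardUpTo, next_of_gap_eq_zero _ hg, actProb_of_gap_eq_zero hg, actNode_of_gap_eq_zero hg,
    one_mul]

lemma costUpTo_of_gap_eq_zero {σ : Fin N → Strategy N} {s : Node N} (hg : gap σ s = 0)
    (i : Fin N) (n : ℕ) : G.costUpTo σ i (n + 1) s =
      ENNReal.ofReal (G.entryCost s (due σ s) i) + G.costUpTo σ i n (G.act s (due σ s)) := by
  rw [costUpTo, next_of_gap_eq_zero _ hg, actProb_of_gap_eq_zero hg, actNode_of_gap_eq_zero hg,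
    one_mul, expectedTime, window_eq_empty hg]
  simp

lemma costUpTo_mono (σ : Fin N → Strategy N) (i : Fin N) : Monotone (G.costUpTo σ i) := by
  refine monotone_nat_of_le_succ fun n => ?_
  induction n with
  | zero => exact fun s => zero_le
  | succ n ih => exact fun s => add_le_add le_rfl (next_mono ih s)

end NextEvent

/-! ### No strategy earns more than the continuation value -/

section UpperBound

variable (G : TreasureHunt N)

/-- Continuation value of `i` at a node in which her opponents have complied with `σ*`. -/
noncomputable def nodeValue (i : Fin N) (s : Node N) : ℝ≥0∞ :=
  ENNReal.ofReal (G.contValue i s.pub (s.info i).know (s.info i).work)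

/-- Continuation value of `i` when an opponent is about to publish the current stage. -/
noncomputable def pendingValue (i : Fin N) (s : Node N) : ℝ≥0∞ :=
  ENNReal.ofReal (G.rivalValue i s.pub (s.info i).know (s.info i).work)

variable {G}

lemma nextWork_lt {s : Node N} {a : Fin N → Option Action} {j : Fin N} (hc : G.Coherent s j)
    (h : G.nextWork s a j = true) : (s.info j).know < G.M := by
  unfold nextWork at h
  split at h
  · simpa using h
  · simp at h
  · exact hc.know_lt h

lemma act_know {s : Node N} {a : Fin N → Option Action} {i : Fin N} (ha : Quiet i a)
    (hc : G.Coherent s i) : ((G.act s a).info i).know = (s.info i).know := by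
  by_cases h : a i = none ∧ s.nextPub a = s.pub
  · rw [act_info_of_silent G h.1 h.2]
  · rw [act_info_of_not G h, nextPub_of_quiet ha]
    exact max_eq_left (max_le hc.pub_le (level_le_know s a i))

lemma act_work {s : Node N} {a : Fin N → Option Action} {i : Fin N} (ha : Quiet i a)
    (hc : G.Coherent s i) : ((G.act s a).info i).work = G.nextWork s a i := by
  by_cases h : a i = none ∧ s.nextPub a = s.pub
  · rw [act_info_of_silent G h.1 h.2]
    simp [nextWork, h.1]
  · rw [act_info_of_not G h, nextPub_of_quiet ha]
    simp [hc.pub_le, level_le_know s a i]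

/-- No rival publishes at the same moment, so no credit is shared. -/
lemma credit_of_quiet {s : Node N} {a : Fin N → Option Action} {i : Fin N} (ha : Quiet i a) :
    G.credit s a i = ∑ m ∈ Finset.Ico s.pub (s.nextPub a), G.V m := by
  have h1 : Finset.Ico s.pub (s.nextPub a) = Finset.Ico s.pub (s.level a i) := by
    ext m; rw [nextPub_of_quiet ha]; simp only [Finset.mem_Ico]; omega
  rw [h1]
  refine Finset.sum_congr rfl fun m hm => ?_
  have h2 : (Finset.univ.filter fun j => m < s.level a j) = {i} := by
    ext j
    simp only [Finset.mem_filter, Finset.mem_univ, true_and, Finset.mem_singleton]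
    constructor
    · intro h
      by_contra hj
      rw [level_eq_zero (ha j hj)] at h
      exact absurd h (by simp)
    · rintro rfl
      exact (Finset.mem_Ico.1 hm).2
  simp [h2]

/-- Publishing converts unpublished solutions into credit one for one; only the effect of the action
on work remains. -/
lemma Admissible.credit_add_nodeValue (hG : G.Admissible) {s : Node N}
    {a : Fin N → Option Action} {i : Fin N} (ha : Quiet i a) (hc : ∀ j, G.Coherent s j) :
    ENNReal.ofReal (G.credit s a i) + G.nodeValue i (G.act s a) =
      ENNReal.ofReal (G.contValue i s.pub (s.info i).know (G.nextWork s a i)) := by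
  have hle : s.nextPub a ≤ (s.info i).know := by
    rw [nextPub_of_quiet ha]; exact max_le (hc i).pub_le (level_le_know s a i)
  rw [nodeValue, act_pub, act_know ha (hc i), act_work ha (hc i), credit_of_quiet ha,
    ← ENNReal.ofReal_add (hG.sum_V_nonneg (nextPub_le hc a i))
      (hG.contValue_nonneg i (hc i).know_le (nextWork_lt (hc i))),
    contValue_publish i _ (pub_le_nextPub s a) hle]

lemma Admissible.entryCost_nonneg (hG : G.Admissible) {s : Node N} {a : Fin N → Option Action}
    {i : Fin N} (hc : G.Coherent s i) : 0 ≤ G.entryCost s a i := by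
  unfold entryCost
  split_ifs with h
  · exact (hG.F_pos _ (nextWork_lt hc h.2)).le
  · exact le_rfl

lemma Admissible.nodeValue_arg_nonneg (hG : G.Admissible) {s : Node N} {i : Fin N}
    (hc : G.Coherent s i) :
    0 ≤ G.contValue i s.pub (s.info i).know (s.info i).work :=
  hG.contValue_nonneg i hc.know_le hc.know_lt

/-- No action raises the value, net of the fixed cost. -/
lemma Admissible.nodeValue_act_le (hG : G.Admissible) {s : Node N} {a : Fin N → Option Action}
    {i : Fin N} (ha : Quiet i a) (hc : ∀ j, G.Coherent s j) :
    ENNReal.ofReal (G.credit s a i) + G.nodeValue i (G.act s a) ≤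
      ENNReal.ofReal (G.entryCost s a i) + G.nodeValue i s := by
  rw [hG.credit_add_nodeValue ha hc, nodeValue, ← ENNReal.ofReal_add
    (hG.entryCost_nonneg (hc i)) (hG.nodeValue_arg_nonneg (hc i))]
  refine ENNReal.ofReal_le_ofReal ?_
  have hlt := nextWork_lt (a := a) (hc i)
  unfold entryCost
  cases hw : (s.info i).work <;> cases hw' : G.nextWork s a i <;> simp only [hw'] at hlt <;> simp
  · exact contValue_enter i _ (hlt trivial)
  · exact hG.contValue_quit i _ ((hc i).know_lt hw)

lemma Admissible.rate_nonneg (hG : G.Admissible) {s : Node N} {j : Fin N}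
    (hc : G.Coherent s j) : 0 ≤ G.rate s j := by
  unfold rate
  split_ifs with h
  · exact div_nonneg (hG.h_pos j).le (hG.d_pos _ (hc.know_lt h)).le
  · exact le_rfl

lemma Admissible.totalRate_nonneg (hG : G.Admissible) {s : Node N}
    (hc : ∀ j, G.Coherent s j) : 0 ≤ G.totalRate s :=
  Finset.sum_nonneg fun j _ => hG.rate_nonneg (hc j)

lemma Calm.sum_rate {i : Fin N} {s : Node N} (h : G.Calm i s) (hm : s.pub < G.M) :
    ∑ j ∈ Finset.univ.erase i, G.rate s j = G.rivals s.pub i / G.d s.pub := by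
  have h1 : ∀ j ∈ Finset.univ.erase i, G.rate s j =
      if j ∈ G.Istar s.pub then G.h j / G.d s.pub else 0 := fun j hj => by
    obtain ⟨hk, hw⟩ := h j (Finset.ne_of_mem_erase hj)
    rw [rate, hk]
    exact if_congr (hw.trans (and_iff_right hm)) rfl rfl
  rw [Finset.sum_congr rfl h1, ← Finset.sum_filter, rivals, capital, Finset.sum_div]
  refine Finset.sum_congr ?_ fun _ _ => rfl
  ext j; simp [and_comm]

lemma Calm.totalRate_eq {i : Fin N} {s : Node N} (h : G.Calm i s) (hm : s.pub < G.M) :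
    G.totalRate s = G.rivals s.pub i / G.d s.pub +
      if (s.info i).work = true then G.h i / G.d (s.info i).know else 0 := by
  rw [totalRate, ← Finset.add_sum_erase _ _ (Finset.mem_univ i), h.sum_rate hm, add_comm]
  rfl

/-- Value of `i` after scientist `j` has solved the stage on which she works. -/
noncomputable def solvedValue (G : TreasureHunt N) (i : Fin N) (s : Node N) (j : Fin N) : ℝ≥0∞ :=
  if j = i then ENNReal.ofReal (G.contValue i s.pub ((s.info i).know + 1) false)
    else G.pendingValue i s

lemma Admissible.sum_solvedValue (hG : G.Admissible) {i : Fin N} {s : Node N} (h : G.Calm i s)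
    (hc : ∀ j, G.Coherent s j) (hm : s.pub < G.M) :
    ∑ j, ENNReal.ofReal (G.rate s j) * G.solvedValue i s j =
      ENNReal.ofReal (G.rivals s.pub i / G.d s.pub *
          G.rivalValue i s.pub (s.info i).know (s.info i).work +
        (if (s.info i).work = true then G.h i / G.d (s.info i).know else 0) *
          G.contValue i s.pub ((s.info i).know + 1) false) := by
  have hR : 0 ≤ G.rivals s.pub i / G.d s.pub :=
    div_nonneg (hG.rivals_nonneg _ i) (hG.d_pos _ hm).le
  have h1 : ∑ j ∈ Finset.univ.erase i, ENNReal.ofReal (G.rate s j) * G.solvedValue i s j =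
      ENNReal.ofReal (G.rivals s.pub i / G.d s.pub *
        G.rivalValue i s.pub (s.info i).know (s.info i).work) := by
    rw [ENNReal.ofReal_mul hR, ← h.sum_rate hm,
      ENNReal.ofReal_sum_of_nonneg fun j _ => hG.rate_nonneg (hc j), Finset.sum_mul]
    refine Finset.sum_congr rfl fun j hj => ?_
    rw [solvedValue, if_neg (Finset.ne_of_mem_erase hj), pendingValue]
  rw [← Finset.add_sum_erase _ _ (Finset.mem_univ i), h1, solvedValue, if_pos rfl, add_comm,
    ← ENNReal.ofReal_mul (hG.rate_nonneg (hc i)), ← ENNReal.ofReal_add]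
  · rfl
  · exact mul_nonneg hR (hG.rivalValue_nonneg i hm (hc i).know_le (hc i).know_lt)
  · unfold rate
    split_ifs with hw
    · exact mul_nonneg (div_nonneg (hG.h_pos i).le (hG.d_pos _ ((hc i).know_lt hw)).le)
        (hG.contValue_nonneg i ((hc i).know_lt hw) (by simp))
    · simp

lemma rate_eq_zero {s : Node N} {j : Fin N} (hc : G.Coherent s j) (hm : ¬ s.pub < G.M) :
    G.rate s j = 0 := by
  rw [rate, if_neg fun hw => hm (hc.pub_le.trans_lt (hc.know_lt hw))]

/-- On average the value does not increase while time passes. -/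
lemma Admissible.sum_solvedValue_le (hG : G.Admissible) {i : Fin N} {s : Node N} (h : G.Calm i s)
    (hc : ∀ j, G.Coherent s j) :
    ∑ j, ENNReal.ofReal (G.rate s j) * G.solvedValue i s j ≤
      ENNReal.ofReal (G.totalRate s) * G.nodeValue i s +
        if (s.info i).work = true then ENNReal.ofReal (G.h i * G.x) else 0 := by
  by_cases hm : s.pub < G.M
  · have hx : ENNReal.ofReal (if (s.info i).work = true then G.h i * G.x else 0) =
        if (s.info i).work = true then ENNReal.ofReal (G.h i * G.x) else 0 := by
      split_ifs <;> simp
    rw [hG.sum_solvedValue h hc hm, nodeValue, ← hx,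
      ← ENNReal.ofReal_mul (hG.totalRate_nonneg hc), ← ENNReal.ofReal_add, h.totalRate_eq hm]
    · exact ENNReal.ofReal_le_ofReal (hG.drift_le i hm (hc i).pub_le (hc i).know_lt)
    · exact mul_nonneg (hG.totalRate_nonneg hc) (hG.nodeValue_arg_nonneg (hc i))
    · split_ifs
      · exact mul_nonneg (hG.h_pos i).le hG.x_nonneg
      · exact le_rfl
  · simp [rate_eq_zero (hc _) hm]

/-- Facts about the publication of a stage that an opponent of `i` has just solved. -/
lemma Calm.publish {i j : Fin N} {x : Node N} (h : G.Calm i x) (hx : G.Reachable x) (hj : j ≠ i)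
    (hw : (x.info j).work = true) {a : Fin N → Option Action}
    (ha : a = Function.update (fun _ => none) j (some (Action.publish (x.pub + 1)))) :
    G.Reachable (G.act (x.solve j) a) ∧ G.Compliant i (G.act (x.solve j) a) ∧
      G.credit (x.solve j) a i = 0 ∧ G.entryCost (x.solve j) a i = 0 ∧
      (G.act (x.solve j) a).pub = x.pub + 1 ∧
      ((G.act (x.solve j) a).info i).know = max (x.info i).know (x.pub + 1) ∧
      G.nodeValue i (G.act (x.solve j) a) = G.pendingValue i x := by
  have haj : a j = some (Action.publish (x.pub + 1)) := by simp [ha]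
  have hak : ∀ k, k ≠ j → a k = none := fun k hk => by simp [ha, hk]
  have hkn : ((x.solve j).info j).know = x.pub + 1 := by
    rw [Node.solve_info_self]; simp [(h j hj).1]
  have hlj : (x.solve j).level a j = x.pub + 1 := by
    rw [level_publish haj, hkn]; simp
  have hlk : ∀ k, k ≠ j → (x.solve j).level a k = 0 := fun k hk =>
    level_eq_zero (Or.inl (hak k hk))
  have hnp : (x.solve j).nextPub a = x.pub + 1 := by
    rw [Node.nextPub, sup_level_of_forall_ne hlk, hlj]; simp
  have hne : (x.solve j).nextPub a ≠ (x.solve j).pub := by rw [hnp]; simp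
  have hinfo := act_info_of_not G (s := x.solve j) (a := a) (j := i) (fun h => hne h.2)
  have hwork : G.nextWork (x.solve j) a i = (x.info i).work := by
    simp [nextWork, hak i hj.symm, Node.solve_info_of_ne x hj.symm]
  rw [hnp, hwork, Node.solve_info_of_ne x hj.symm] at hinfo
  refine ⟨(Reachable.solve x j hx hw).act _ _, Or.inr (fresh_act hne fun k hk => ?_), ?_, ?_, hnp,
    by rw [hinfo], ?_⟩
  · rw [hnp]
    by_cases hkj : k = j
    · subst hkj
      refine Or.inr ⟨hkn, ?_⟩
      simp [nextWork, haj, Node.solve_info_self]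
    · left
      rw [Node.solve_info_of_ne x hkj, (h k hk).1]
      exact Nat.lt_succ_self _
  · simp [credit, hlk i hj.symm]
  · rw [entryCost, hwork, Node.solve_info_of_ne x hj.symm, if_neg]
    rintro ⟨h1, h2⟩
    rw [h1] at h2
    exact absurd h2 (by simp)
  · rw [nodeValue, pendingValue, rivalValue, act_pub, hnp, hinfo, Bool.and_comm]

lemma nodeValue_solve {i : Fin N} (s : Node N) :
    G.nodeValue i (s.solve i) =
      ENNReal.ofReal (G.contValue i s.pub ((s.info i).know + 1) false) := by
  rw [nodeValue, Node.solve_info_self, Node.solve_pub]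

/-- Against opponents who follow `σ*`, no strategy of `i` earns more than the continuation
value. -/
theorem Admissible.rewardUpTo_le (hG : G.Admissible) (i : Fin N) (τ : Strategy N) (n : ℕ) :
    (∀ s, G.Reachable s → G.Compliant i s →
      G.rewardUpTo (Function.update G.sigmaStar i τ) i n s ≤
        G.costUpTo (Function.update G.sigmaStar i τ) i n s + G.nodeValue i s) ∧
    (∀ x j, G.Reachable x → G.Calm i x → j ≠ i → (x.info j).work = true →
      (x.time : ℝ≥0∞) < alarm τ (x.info i) →
      G.rewardUpTo (Function.update G.sigmaStar i τ) i n (x.solve j) ≤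
        G.costUpTo (Function.update G.sigmaStar i τ) i n (x.solve j) + G.pendingValue i x) := by
  set σ := Function.update G.sigmaStar i τ with hσ
  induction n with
  | zero => exact ⟨fun _ _ _ => zero_le, fun _ _ _ _ _ _ _ => zero_le⟩
  | succ n ih =>
    refine ⟨fun s hs hcomp => ?_, fun x j hx hcalm hj hw hτ => ?_⟩
    · have hc := hs.coherent
      -- Either some action is due and no time passes, or no rival is due and they are calm until
      -- the next event.
      by_cases hg : gap σ s = 0
      · have ha : ∀ j, j ≠ i → due σ s j = due G.sigmaStar s j := fun j hj =>
          due_update_of_ne _ _ _ hj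
        have hq : Quiet i (due σ s) := fun j hj => by
          rw [ha j hj]; exact hcomp.due_eq hc j hj
        rw [rewardUpTo_of_gap_eq_zero hg, costUpTo_of_gap_eq_zero hg]
        calc _ ≤ ENNReal.ofReal (G.credit s (due σ s) i) +
              (G.costUpTo σ i n (G.act s (due σ s)) + G.nodeValue i (G.act s (due σ s))) :=
              add_le_add le_rfl (ih.1 _ (hs.act _ _) (hcomp.act hc ha))
          _ = ENNReal.ofReal (G.credit s (due σ s) i) + G.nodeValue i (G.act s (due σ s)) +
              G.costUpTo σ i n (G.act s (due σ s)) := by ring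
          _ ≤ ENNReal.ofReal (G.entryCost s (due σ s) i) + G.nodeValue i s +
              G.costUpTo σ i n (G.act s (due σ s)) :=
              add_le_add (hG.nodeValue_act_le hq hc) le_rfl
          _ = _ := by ring
      · have hcalm : G.Calm i s := hcomp.calm_of_not_due hc fun j hj => by
          rw [← due_update_of_ne G.sigmaStar τ s hj]
          exact due_eq_none (not_due_of_gap_ne_zero hg j)
        have hs' : G.Reachable (actNode σ s) := hs.advance s _
        set a := due σ (actNode σ s) with ha
        have hdue : ∀ j, j ≠ i → a j = due G.sigmaStar (actNode σ s) j := fun j hj =>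
          due_update_of_ne _ _ _ hj
        have hcomp' : G.Compliant i (actNode σ s) := Or.inl (hcalm.advance _)
        have hq : Quiet i a := fun j hj => by
          rw [hdue j hj]; exact hcomp'.due_eq hs'.coherent j hj
        have hnext : G.next σ ⊤ (G.rewardUpTo σ i n) s ≤ G.next σ ⊤ (G.costUpTo σ i n) s +
            ((∑ j, ENNReal.ofReal (G.rate s j) * G.solvedValue i s j) * G.expectedTime σ s +
              actProb G σ s * G.nodeValue i (G.act (actNode σ s) a)) := by
          refine next_le_add (fun j => hG.rate_nonneg (hc j)) (fun j v _ hv hw => ?_) fun _ =>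
            ih.1 _ (hs'.act _ _) (hcomp'.act hs'.coherent hdue)
          have hr : G.Reachable (s.advance v) := hs.advance s v
          by_cases hj : j = i
          · subst hj
            have := ih.1 _ (hr.solve _ _ hw) (Compliant.solve_self (Or.inl (hcalm.advance v)))
            rw [nodeValue_solve] at this
            rw [solvedValue, if_pos rfl]
            exact this
          · rw [solvedValue, if_neg hj]
            -- Since `v` is below the gap, `i` is not due at this date, so her action cannot
            -- coincide with the rival's publication.
            refine ih.2 (s.advance v) j hr (hcalm.advance v) hj hw ?_
            have := lt_alarm_of_lt_gap hv i
            rwa [hσ, Function.update_self] at this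
        have h1 := hG.nodeValue_act_le hq hs'.coherent
        have hval : G.nodeValue i (actNode σ s) = G.nodeValue i s := rfl
        rw [hval] at h1
        have h2 := hG.sum_solvedValue_le hcalm hc
        have h3 := ofReal_totalRate_mul_expectedTime_le G σ (hG.totalRate_nonneg hc)
        rw [rewardUpTo, costUpTo]
        set p := actProb G σ s
        set L := G.expectedTime σ s
        set W := G.nodeValue i s
        set C := G.next σ ⊤ (G.costUpTo σ i n) s
        have hx : (if (s.info i).work = true then ENNReal.ofReal (G.h i * G.x) else 0) * L =
            if (s.info i).work = true then ENNReal.ofReal (G.h i * G.x) * L else 0 := by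
          split_ifs <;> simp
        rw [← hx]
        set X := if (s.info i).work = true then ENNReal.ofReal (G.h i * G.x) else 0
        set E := ENNReal.ofReal (G.entryCost (actNode σ s) a i)
        calc _ ≤ p * ENNReal.ofReal (G.credit (actNode σ s) a i) + (C +
              ((∑ j, ENNReal.ofReal (G.rate s j) * G.solvedValue i s j) * L +
                p * G.nodeValue i (G.act (actNode σ s) a))) := add_le_add le_rfl hnext
          _ = C + (∑ j, ENNReal.ofReal (G.rate s j) * G.solvedValue i s j) * L +
              p * (ENNReal.ofReal (G.credit (actNode σ s) a i) +
                G.nodeValue i (G.act (actNode σ s) a)) := by ring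
          _ ≤ C + (ENNReal.ofReal (G.totalRate s) * W + X) * L + p * (E + W) :=
              add_le_add (add_le_add le_rfl (mul_le_mul_left h2 L)) (mul_le_mul_right h1 p)
          _ = X * L + p * E + C + (ENNReal.ofReal (G.totalRate s) * L + p) * W := by ring
          _ ≤ X * L + p * E + C + 1 * W := add_le_add le_rfl (mul_le_mul_left h3 W)
          _ = _ := by ring
    · obtain ⟨hg, hdue⟩ := hcalm.due_solve hx hj hw hτ
      obtain ⟨h1, h2, h3, h4, -, -, h7⟩ := hcalm.publish hx hj hw hdue
      rw [rewardUpTo_of_gap_eq_zero hg, costUpTo_of_gap_eq_zero hg, h3, h4, ← h7]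
      simpa using ih.1 _ h1 h2

end UpperBound

/-! ### The profile `σ*` earns the continuation value -/

section LowerBound

variable {G : TreasureHunt N}

/-- Under `σ*`, scientist `i` earns at least `w` after the node `s` within any number `n ≥ n₀` of
events, and her costs are bounded by `B`. -/
def Attains (G : TreasureHunt N) (i : Fin N) (s : Node N) (w : ℝ≥0∞) (n₀ : ℕ) (B : ℝ≥0∞) : Prop :=
  (∀ n, n₀ ≤ n → G.costUpTo G.sigmaStar i n s + w ≤ G.rewardUpTo G.sigmaStar i n s) ∧
    ∀ n, G.costUpTo G.sigmaStar i n s ≤ B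

lemma Attains.mono {i : Fin N} {s : Node N} {w : ℝ≥0∞} {n₀ n₁ : ℕ} {B B' : ℝ≥0∞}
    (h : G.Attains i s w n₀ B) (hn : n₀ ≤ n₁) (hB : B ≤ B') : G.Attains i s w n₁ B' :=
  ⟨fun n hn' => h.1 n (hn.trans hn'), fun n => (h.2 n).trans hB⟩

lemma Attains.of_act {i : Fin N} {s : Node N} {w w' : ℝ≥0∞} {n₀ : ℕ} {B E : ℝ≥0∞}
    (hg : gap G.sigmaStar s = 0) (h : G.Attains i (G.act s (due G.sigmaStar s)) w' n₀ B)
    (hw : ENNReal.ofReal (G.entryCost s (due G.sigmaStar s) i) + w ≤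
      ENNReal.ofReal (G.credit s (due G.sigmaStar s) i) + w')
    (hE : ENNReal.ofReal (G.entryCost s (due G.sigmaStar s) i) ≤ E) :
    G.Attains i s w (n₀ + 1) (E + B) := by
  refine ⟨fun n hn => ?_, fun n => ?_⟩
  · obtain ⟨n, rfl⟩ : ∃ k, n = k + 1 := ⟨n - 1, by omega⟩
    rw [rewardUpTo_of_gap_eq_zero hg, costUpTo_of_gap_eq_zero hg]
    set c := G.costUpTo G.sigmaStar i n (G.act s (due G.sigmaStar s))
    calc _ = ENNReal.ofReal (G.entryCost s (due G.sigmaStar s) i) + w + c := by ring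
      _ ≤ ENNReal.ofReal (G.credit s (due G.sigmaStar s) i) + w' + c := add_le_add hw le_rfl
      _ = ENNReal.ofReal (G.credit s (due G.sigmaStar s) i) + (c + w') := by ring
      _ ≤ _ := add_le_add le_rfl (h.1 n (by omega))
  · cases n with
    | zero => exact zero_le
    | succ n =>
      rw [costUpTo_of_gap_eq_zero hg]
      exact add_le_add hE (h.2 n)

lemma alarm_sigmaStar_of_eq {s : Node N} {i : Fin N} (hc : G.Coherent s i)
    (hk : (s.info i).know = s.pub) (hi : (s.info i).work = true ∨ ¬ (s.pub < G.M ∧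
      i ∈ G.Istar s.pub)) : alarm (G.sigmaStar i) (s.info i) = ⊤ := by
  rw [alarm, sigmaStar_of_eq (hc.pub_eq.trans hk.symm), if_neg]
  · simp
  · rintro ⟨h1, h2⟩
    rw [hk] at h2
    rcases hi with hi | hi
    · rw [h1] at hi; exact absurd hi (by simp)
    · exact hi h2

lemma due_sigmaStar_publish {s : Node N} {i : Fin N} (hc : G.Coherent s i)
    (hk : s.pub < (s.info i).know) : alarm (G.sigmaStar i) (s.info i) ≤ s.time ∧
      due G.sigmaStar s i = some (Action.publish (s.info i).know) := by
  have hσ : G.sigmaStar i (s.info i) = (0, Action.publish (s.info i).know) := by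
    rw [sigmaStar, hc.pub_eq, if_pos hk]
  have h1 : alarm (G.sigmaStar i) (s.info i) ≤ s.time := by
    rw [alarm, hσ, add_zero]; exact_mod_cast hc.last_le
  exact ⟨h1, by rw [due_eq_some h1, hσ]⟩

lemma due_sigmaStar_enter {s : Node N} {i : Fin N} (hc : G.Coherent s i)
    (hk : (s.info i).know = s.pub) (hw : (s.info i).work = false) (hm : s.pub < G.M)
    (hi : i ∈ G.Istar s.pub) : alarm (G.sigmaStar i) (s.info i) ≤ s.time ∧
      due G.sigmaStar s i = some Action.enter := by
  have hσ : G.sigmaStar i (s.info i) = (0, Action.enter) := by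
    rw [sigmaStar_of_eq (hc.pub_eq.trans hk.symm), if_pos ⟨hw, by rwa [hk], by rwa [hk]⟩]
  have h1 : alarm (G.sigmaStar i) (s.info i) ≤ s.time := by
    rw [alarm, hσ, add_zero]; exact_mod_cast hc.last_le
  exact ⟨h1, by rw [due_eq_some h1, hσ]⟩

/-- Unpublished results are published at once, at no cost. -/
lemma Admissible.attains_publish (hG : G.Admissible) {i : Fin N} {s : Node N}
    (hs : G.Reachable s) (hcomp : G.Compliant i s) (hk : s.pub < (s.info i).know) {n₀ : ℕ}
    {B : ℝ≥0∞}
    (h : ∀ t, G.Reachable t → G.Compliant i t → t.pub = (s.info i).know →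
      (t.info i).know = (s.info i).know → G.Attains i t (G.nodeValue i t) n₀ B) :
    G.Attains i s (G.nodeValue i s) (n₀ + 1) B := by
  have hc := hs.coherent
  obtain ⟨h1, h2⟩ := due_sigmaStar_publish (hc i) hk
  have hq := hcomp.due_eq hc
  have hpub : s.nextPub (due G.sigmaStar s) = (s.info i).know := by
    rw [nextPub_of_quiet hq, level_publish h2, min_self, if_pos hk, max_eq_right hk.le]
  have hwork : G.nextWork s (due G.sigmaStar s) i = (s.info i).work := by
    simp [nextWork, h2]
  have hentry : G.entryCost s (due G.sigmaStar s) i = 0 := by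
    rw [entryCost, hwork, if_neg]
    rintro ⟨h1, h2⟩
    rw [h1] at h2
    exact absurd h2 (by simp)
  have := Attains.of_act (E := 0) (w := G.nodeValue i s) (gap_eq_zero h1)
    (h _ (hs.act _ _) (hcomp.act hc fun _ _ => rfl) hpub (act_know hq (hc i)))
    (by rw [hG.credit_add_nodeValue hq hc, hwork, hentry]; simp [nodeValue]) (by simp [hentry])
  simpa using this

/-- A stage that an opponent has solved is published at once. -/
lemma Calm.attains_pending {i j : Fin N} {x : Node N} (hcalm : G.Calm i x) (hx : G.Reachable x)
    (hj : j ≠ i) (hw : (x.info j).work = true) (hk : (x.info i).know = x.pub)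
    (hτ : alarm (G.sigmaStar i) (x.info i) = ⊤) {n₀ : ℕ} {B : ℝ≥0∞}
    (h : ∀ t, G.Reachable t → G.Compliant i t → t.pub = x.pub + 1 →
      (t.info i).know = x.pub + 1 → G.Attains i t (G.nodeValue i t) n₀ B) :
    G.Attains i (x.solve j) (G.pendingValue i x) (n₀ + 1) B := by
  obtain ⟨hg, hdue⟩ := hcalm.due_solve hx hj hw (τ := G.sigmaStar i)
    (by rw [hτ]; exact ENNReal.coe_lt_top)
  rw [Function.update_eq_self] at hg hdue
  obtain ⟨h1, h2, h3, h4, h5, h6, h7⟩ := hcalm.publish hx hj hw hdue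
  rw [hk, max_eq_right (Nat.le_succ _)] at h6
  have := Attains.of_act (E := 0) (w := G.pendingValue i x) hg (h _ h1 h2 h5 h6)
    (by rw [h3, h4, h7]) (by simp [h4])
  simpa using this

/-- Either `i` works or the nonempty group `Istar` works without her. A next solution therefore
comes almost surely, and no value is lost in endless waiting. -/
lemma Admissible.totalRate_pos (hG : G.Admissible) {i : Fin N} {s : Node N} (h : G.Calm i s)
    (hm : s.pub < G.M) (hk : (s.info i).know = s.pub)
    (hi : (s.info i).work = true ∨ i ∉ G.Istar s.pub) : 0 < G.totalRate s := by
  have hd := hG.d_pos _ hm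
  have h1 : 0 ≤ G.rivals s.pub i / G.d s.pub := div_nonneg (hG.rivals_nonneg _ i) hd.le
  rw [h.totalRate_eq hm, hk]
  split_ifs with hw
  · exact add_pos_of_nonneg_of_pos h1 (div_pos (hG.h_pos i) hd)
  · rw [add_zero, rivals, Finset.erase_eq_of_notMem (hi.resolve_left hw)]
    obtain ⟨j, hj⟩ := Istar_nonempty hG.h_pos (hG.F_lt _ hm) i
    exact div_pos (capital_pos hG.h_pos hj) hd

/-- While everybody works as prescribed, the value is earned if it is earned after the next
solution. -/
lemma Admissible.attains_wait (hG : G.Admissible) {i : Fin N} {s : Node N} (hs : G.Reachable s)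
    (h : G.Calm i s) (hm : s.pub < G.M) (hk : (s.info i).know = s.pub)
    (hi : (s.info i).work = true ∨ i ∉ G.Istar s.pub) {n₀ : ℕ} {B : ℝ≥0∞}
    (hsolve : ∀ j (v : ℝ≥0), (s.info j).work = true →
      G.Attains i ((s.advance v).solve j) (G.solvedValue i s j) n₀ B) :
    G.Attains i s (G.nodeValue i s) (n₀ + 1)
      (ENNReal.ofReal (G.h i * G.x) * (ENNReal.ofReal (G.h i / G.d s.pub))⁻¹ + B) := by
  have hc := hs.coherent
  have hgap : gap G.sigmaStar s = ⊤ := by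
    have := h.gap_eq hc (G.sigmaStar i)
    rw [Function.update_eq_self, alarm_sigmaStar_of_eq (hc i) hk
      (hi.imp_right fun hi hcon => hi hcon.2)] at this
    simpa using this
  have hp : actProb G G.sigmaStar s = 0 := by simp [actProb, hgap]
  have hpos := hG.totalRate_pos h hm hk hi
  have hL := ofReal_totalRate_mul_expectedTime G G.sigmaStar hpos
  rw [hp, add_zero] at hL
  set L := G.expectedTime G.sigmaStar s with hLdef
  have hr : ∀ j, 0 ≤ G.rate s j := fun j => hG.rate_nonneg (hc j)
  set X := if (s.info i).work = true then ENNReal.ofReal (G.h i * G.x) else 0 with hX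
  have hcost : ∀ n, G.costUpTo G.sigmaStar i (n + 1) s =
      X * L + G.next G.sigmaStar ⊤ (G.costUpTo G.sigmaStar i n) s := fun n => by
    rw [costUpTo, hp, zero_mul, add_zero, hX]
    split_ifs <;> simp [hLdef]
  -- While she works, the total rate is at least her own, so she pays for an expected time of at
  -- most `(h i / d)⁻¹`.
  have hXL : X * L ≤ ENNReal.ofReal (G.h i * G.x) *
      (ENNReal.ofReal (G.h i / G.d s.pub))⁻¹ := by
    rw [hX]
    split_ifs with hw
    · refine mul_le_mul_right ?_ _
      rw [ENNReal.le_inv_iff_mul_le, ← hL, mul_comm]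
      refine mul_le_mul_left (ENNReal.ofReal_le_ofReal ?_) _
      rw [h.totalRate_eq hm, if_pos hw, hk]
      have : 0 ≤ G.rivals s.pub i / G.d s.pub :=
        div_nonneg (hG.rivals_nonneg _ i) (hG.d_pos _ hm).le
      linarith
    · simp
  have hdrift : (∑ j, ENNReal.ofReal (G.rate s j) * G.solvedValue i s j) =
      ENNReal.ofReal (G.totalRate s) * G.nodeValue i s + X := by
    have hx : X = ENNReal.ofReal (if (s.info i).work = true then G.h i * G.x else 0) := by
      rw [hX]; split_ifs <;> simp
    rw [hG.sum_solvedValue h hc hm, nodeValue, hx, ← ENNReal.ofReal_mul hpos.le,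
      ← ENNReal.ofReal_add, h.totalRate_eq hm, hk, hG.drift_eq i hm hi]
    · exact mul_nonneg hpos.le (hG.nodeValue_arg_nonneg (hc i))
    · split_ifs
      · exact mul_nonneg (hG.h_pos i).le hG.x_nonneg
      · exact le_rfl
  refine ⟨fun n hn => ?_, fun n => ?_⟩
  · obtain ⟨n, rfl⟩ : ∃ k, n = k + 1 := ⟨n - 1, by omega⟩
    have hnext := add_le_next (σ := G.sigmaStar) (f := G.rewardUpTo G.sigmaStar i n)
      (g := G.costUpTo G.sigmaStar i n) (s := s) hr (K := G.solvedValue i s) (K' := 0)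
      (fun j v _ _ hw => (hsolve j v hw).1 n (by omega))
      (fun hlt => absurd hgap hlt.ne)
    rw [hp, zero_mul, add_zero, hdrift] at hnext
    rw [hcost, rewardUpTo, hp, zero_mul, zero_add]
    refine le_trans (le_of_eq ?_) hnext
    calc _ = G.next G.sigmaStar ⊤ (G.costUpTo G.sigmaStar i n) s +
          (1 * G.nodeValue i s + X * L) := by ring
      _ = G.next G.sigmaStar ⊤ (G.costUpTo G.sigmaStar i n) s +
          (ENNReal.ofReal (G.totalRate s) * L * G.nodeValue i s + X * L) := by rw [hL]
      _ = _ := by ring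
  · cases n with
    | zero => exact zero_le
    | succ n =>
      rw [hcost]
      refine add_le_add hXL ?_
      have hnext := next_le_add (σ := G.sigmaStar) (f := G.costUpTo G.sigmaStar i n)
        (g := fun _ => 0) (s := s) hr (K := fun _ => B) (K' := 0)
        (fun j v _ _ hw => by rw [zero_add]; exact (hsolve j v hw).2 n)
        (fun hlt => absurd hgap hlt.ne)
      have h0 : G.next G.sigmaStar ⊤ (fun _ => 0) s = 0 := by simp [next]
      rw [h0, hp, zero_mul, add_zero, zero_add, ← Finset.sum_mul,
        ← ENNReal.ofReal_sum_of_nonneg fun j _ => hr j] at hnext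
      calc _ ≤ ENNReal.ofReal (G.totalRate s) * B * L := hnext
        _ = ENNReal.ofReal (G.totalRate s) * L * B := by ring
        _ = B := by rw [hL, one_mul]

/-- When all stages are published, nothing happens any more. -/
lemma Calm.attains_end {i : Fin N} {s : Node N} (hs : G.Reachable s) (h : G.Calm i s)
    (hm : s.pub = G.M) : G.Attains i s (G.nodeValue i s) 0 0 := by
  have hc := hs.coherent
  have hk : (s.info i).know = s.pub :=
    le_antisymm ((hc i).know_le.trans hm.ge) (hc i).pub_le
  have hm' : ¬ s.pub < G.M := by omega
  have hw : (s.info i).work = false := by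
    by_contra hw
    have := (hc i).know_lt (by simpa using hw)
    omega
  have hgap : gap G.sigmaStar s = ⊤ := by
    have := h.gap_eq hc (G.sigmaStar i)
    rw [Function.update_eq_self, alarm_sigmaStar_of_eq (hc i) hk
      (Or.inr fun hcon => hm' hcon.1)] at this
    simpa using this
  have hcost : ∀ n, G.costUpTo G.sigmaStar i n s = 0 := by
    intro n
    cases n with
    | zero => rfl
    | succ n => simp [costUpTo, hw, actProb, hgap, next, rate_eq_zero (hc _) hm']
  have hval : G.nodeValue i s = 0 := by
    simp [nodeValue, hk, hw, contValue, idleValue, hm]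
  exact ⟨fun n _ => by simp [hcost, hval], fun n => (hcost n).le⟩

/-- Under `σ*` the continuation value is earned from every stage on. -/
lemma Admissible.exists_attains_stage (hG : G.Admissible) (i : Fin N) (δ : ℕ) : ∀ m, m + δ = G.M →
    ∃ n₀ B, B ≠ ⊤ ∧ ∀ s, G.Reachable s → G.Compliant i s → s.pub = m → (s.info i).know = m →
      G.Attains i s (G.nodeValue i s) n₀ B := by
  induction δ with
  | zero =>
    intro m hm
    refine ⟨0, 0, by simp, fun s hs hcomp hp _ => ?_⟩
    have hp' : s.pub = G.M := by omega
    refine Calm.attains_end hs (hcomp.calm_of_not_due hs.coherent fun j hj => ?_) hp'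
    rcases hcomp with h | h
    · exact h.due_eq_none hj (hs.coherent j)
    · rw [h.due_eq hj (hs.coherent j), if_neg (by omega)]
  | succ δ ih =>
    intro m hm
    obtain ⟨n₀, B, hB, hnext⟩ := ih (m + 1) (by omega)
    have hmM : m < G.M := by omega
    set D := ENNReal.ofReal (G.h i * G.x) * (ENNReal.ofReal (G.h i / G.d m))⁻¹ with hD
    have hDtop : D ≠ ⊤ := by
      refine ENNReal.mul_ne_top ENNReal.ofReal_ne_top (ENNReal.inv_ne_top.2 ?_)
      exact (ENNReal.ofReal_pos.2 (div_pos (hG.h_pos i) (hG.d_pos m hmM))).ne'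
    have hwait : ∀ s, G.Reachable s → G.Calm i s → s.pub = m → (s.info i).know = m →
        ((s.info i).work = true ∨ i ∉ G.Istar m) →
        G.Attains i s (G.nodeValue i s) (n₀ + 2) (D + B) := by
      intro s hs hcalm hp hk hi
      subst hp
      refine hG.attains_wait hs hcalm hmM hk hi fun j v hw => ?_
      have hr : G.Reachable (s.advance v) := hs.advance s v
      by_cases hj : j = i
      · subst hj
        rw [solvedValue, if_pos rfl]
        have hkn : (((s.advance v).solve j).info j).know = s.pub + 1 := by
          rw [Node.solve_info_self, Node.advance_info, hk]
        have := hG.attains_publish (s := (s.advance v).solve j) (hr.solve _ _ hw)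
          (Compliant.solve_self (Or.inl (hcalm.advance v)))
          (by rw [hkn]; simp) (n₀ := n₀) (B := B) (by rw [hkn]; exact hnext)
        rwa [nodeValue_solve] at this
      · rw [solvedValue, if_neg hj]
        exact Calm.attains_pending (hcalm.advance v) hr hj hw hk
          (alarm_sigmaStar_of_eq (hr.coherent i) hk (hi.imp_right fun hi hcon => hi hcon.2)) hnext
    -- A stage takes at most three events: immediate entries, a solution and its publication.
    refine ⟨n₀ + 3, ENNReal.ofReal (G.F m) + (D + B),
      ENNReal.add_ne_top.2 ⟨ENNReal.ofReal_ne_top, ENNReal.add_ne_top.2 ⟨hDtop, hB⟩⟩,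
      fun s hs hcomp hp hk => ?_⟩
    have hc := hs.coherent
    subst hp
    by_cases hg : gap G.sigmaStar s = 0
    · have hq := hcomp.due_eq hc
      by_cases hcond : (s.info i).work = false ∧ i ∈ G.Istar s.pub
      · obtain ⟨h1, h2⟩ := due_sigmaStar_enter (hc i) hk hcond.1 hmM hcond.2
        have hnp := nextPub_of_none (s := s) hq (Or.inr h2)
        have hnw : G.nextWork s (due G.sigmaStar s) i = true := by simp [nextWork, h2, hk, hmM]
        have hentry : G.entryCost s (due G.sigmaStar s) i = G.F s.pub := by
          rw [entryCost, if_pos ⟨hcond.1, hnw⟩, hk]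
        refine Attains.of_act hg (hwait _ (hs.act _ _) (hcomp.calm_act hc (fun _ _ => rfl) hnp) hnp
          ((act_know hq (hc i)).trans hk) (Or.inl ((act_work hq (hc i)).trans hnw))) ?_ ?_
        · rw [hG.credit_add_nodeValue hq hc, hnw, hentry, nodeValue, hk, hcond.1,
            ← hG.contValue_enter_of_mem _ hmM hcond.2, ENNReal.ofReal_add (hG.F_pos _ hmM).le]
          exact hG.contValue_nonneg i hmM.le (by simp)
        · rw [hentry]
      · have hi : (s.info i).work = true ∨ i ∉ G.Istar s.pub := by
          cases hw : (s.info i).work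
          · exact Or.inr fun hi => hcond ⟨hw, hi⟩
          · exact Or.inl rfl
        have h2 : due G.sigmaStar s i = none := due_eq_none (by
          rw [alarm_sigmaStar_of_eq (hc i) hk (hi.imp_right fun hi hcon => hi hcon.2)]
          exact ENNReal.coe_lt_top)
        have hnp := nextPub_of_none (s := s) hq (Or.inl h2)
        have hnw : G.nextWork s (due G.sigmaStar s) i = (s.info i).work := by simp [nextWork, h2]
        have hentry : G.entryCost s (due G.sigmaStar s) i = 0 := by
          rw [entryCost, hnw, if_neg]
          rintro ⟨h1, h2⟩
          rw [h1] at h2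
          exact absurd h2 (by simp)
        refine Attains.of_act hg (hwait _ (hs.act _ _) (hcomp.calm_act hc (fun _ _ => rfl) hnp) hnp
          ((act_know hq (hc i)).trans hk) ?_) ?_ ?_
        · rw [act_work hq (hc i), hnw]; exact hi
        · rw [hG.credit_add_nodeValue hq hc, hnw, hentry]; simp [nodeValue]
        · simp [hentry]
    · have hcalm : G.Calm i s := hcomp.calm_of_not_due hc fun j hj =>
        due_eq_none (not_due_of_gap_ne_zero hg j)
      refine (hwait s hs hcalm rfl hk ?_).mono (by omega) le_add_self
      cases hw : (s.info i).work
      · refine Or.inr fun hi => hg ?_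
        exact gap_eq_zero (due_sigmaStar_enter (hc i) hk hw hmM hi).1
      · exact Or.inl rfl

/-- Under `σ*` the continuation value is earned from every node in which the opponents have
complied. -/
theorem Admissible.exists_attains (hG : G.Admissible) {i : Fin N} {s : Node N}
    (hs : G.Reachable s) (hcomp : G.Compliant i s) :
    ∃ n₀ B, B ≠ ⊤ ∧ G.Attains i s (G.nodeValue i s) n₀ B := by
  have hc := hs.coherent i
  obtain ⟨n₀, B, hB, h⟩ := hG.exists_attains_stage i (G.M - (s.info i).know) (s.info i).know
    (Nat.add_sub_cancel' hc.know_le)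
  rcases hc.pub_le.eq_or_lt with heq | hlt
  · exact ⟨n₀, B, hB, h s hs hcomp heq rfl⟩
  · exact ⟨n₀ + 1, B, hB, hG.attains_publish hs hcomp hlt h⟩

end LowerBound

/-! ### Equilibrium -/

section Equilibrium

variable {G : TreasureHunt N}

/-- An infinite cost `C` makes the deviation worth `⊥`. Otherwise `R` is finite and both differences
can be compared with `W`. -/
lemma coe_ennreal_sub_le {R C R' C' W : ℝ≥0∞} (h : R ≤ C + W) (h' : C' + W ≤ R') (hC' : C' ≠ ⊤)
    (hW : W ≠ ⊤) : (R : EReal) - (C : EReal) ≤ (R' : EReal) - (C' : EReal) := by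
  by_cases hC : C = ⊤
  · simp [hC]
  have hR : R ≠ ⊤ := ne_top_of_le_ne_top (ENNReal.add_ne_top.2 ⟨hC, hW⟩) h
  lift C to ℝ≥0 using hC
  lift R to ℝ≥0 using hR
  lift C' to ℝ≥0 using hC'
  lift W to ℝ≥0 using hW
  have h1 : (R : ℝ) ≤ C + W := by exact_mod_cast h
  refine le_trans ?_ (EReal.sub_le_sub (EReal.coe_ennreal_le_coe_ennreal_iff.2 h') le_rfl)
  rw [← ENNReal.coe_add]
  simp only [EReal.coe_nnreal_eq_coe_real, NNReal.coe_add, ← EReal.coe_sub]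
  rw [EReal.coe_le_coe_iff]
  linarith

lemma Admissible.payoff_le (hG : G.Admissible) {i : Fin N} {s : Node N} (hs : G.Reachable s)
    (hcomp : G.Compliant i s) (τ : Strategy N) :
    G.payoff (Function.update G.sigmaStar i τ) i (MeasureTheory.Measure.dirac s) ≤
      G.payoff G.sigmaStar i (MeasureTheory.Measure.dirac s) := by
  obtain ⟨n₀, B, hB, h1, h2⟩ := hG.exists_attains hs hcomp
  simp only [payoff, MeasureTheory.lintegral_dirac]
  refine coe_ennreal_sub_le (W := G.nodeValue i s) ?_ ?_
    (ne_top_of_le_ne_top hB (iSup_le h2)) ENNReal.ofReal_ne_top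
  · exact iSup_le fun n => ((hG.rewardUpTo_le i τ n).1 s hs hcomp).trans
      (add_le_add (le_iSup (fun n => G.costUpTo (Function.update G.sigmaStar i τ) i n s) n) le_rfl)
  · rw [ENNReal.iSup_add]
    refine iSup_le fun n => ?_
    -- The value is only guaranteed from `n₀` events on; partial costs increase with the number of
    -- events, so `n` may be enlarged.
    calc _ ≤ G.costUpTo G.sigmaStar i (max n n₀) s + G.nodeValue i s :=
          add_le_add (costUpTo_mono _ i (le_max_left n n₀) s) le_rfl
      _ ≤ G.rewardUpTo G.sigmaStar i (max n n₀) s := h1 _ (le_max_right n n₀)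
      _ ≤ _ := le_iSup (fun n => G.rewardUpTo G.sigmaStar i n s) _

lemma isPublicSharing_sigmaStar (G : TreasureHunt N) : IsPublicSharing G.sigmaStar := by
  intro i I
  refine ⟨fun h => ?_, fun _ hq => ?_⟩
  · rw [sigmaStar, if_pos h]
    exact ⟨rfl, I.know, le_rfl, rfl⟩
  · unfold sigmaStar at hq
    -- `quit` is never prescribed, not even as the idle action of a scientist who waits.
    split_ifs at hq

/-- The profile `σ*` is a perfect Bayesian equilibrium with the beliefs constructed above. -/
theorem Admissible.isPerfectBayesianWith (hG : G.Admissible) :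
    G.IsPerfectBayesianWith G.sigmaStar G.beliefs where
  measurable := measurable_sigmaStar G
  isProbability _ _ _ _ := MeasureTheory.Measure.dirac.isProbabilityMeasure
  supported i I t h := by
    rw [beliefs, MeasureTheory.ae_dirac_eq]
    exact imagined_mem h
  bayes_initial i τ _ := bayesRule_dirac fun n u => .fresh _ .initial rfl
  bayes i I t h τ _ := bayesRule_dirac fun n u => onTrack_imagined h τ n u
  rational i I t h τ _ := by
    obtain ⟨m, hex, -⟩ := imagined_explains h
    exact hG.payoff_le hex.reachable hex.compliant τ

end Equilibrium

end TreasureHunt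

theorem proposition4 {N : ℕ} (G : TreasureHunt N)
    (h_pos : ∀ i, 0 < G.h i) (h_anti : StrictAnti G.h) (hx : 0 ≤ G.x)
    (hV : ∀ m < G.M, 0 < G.V m) (hd : ∀ m < G.M, 0 < G.d m) (hF : ∀ m < G.M, 0 < G.F m)
    (hnontrivial : ∀ m < G.M, 0 < G.V m - G.d m * G.x - G.F m)
    (hcond : ∀ m m', m < m' → m' < G.M → ∀ i,
      0 ≤ G.V m * G.rivals m i / G.d m -
        G.h i / G.d m' *
          ((G.V m' * G.rivals m' i + G.x * G.d m' * G.h i) / (G.h i + G.rivals m' i))) :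
    G.IsPublicSharingEquilibrium G.sigmaStar ∧
      ∀ m < G.M, G.IsRiskDominant m (G.Istar m) := by
  have hA : ∀ m < G.M, G.F m < G.netValue m := fun m hm => by
    have := hnontrivial m hm
    unfold TreasureHunt.netValue
    linarith
  have hG : G.Admissible := ⟨h_pos, h_anti, hx, hV, hd, hF, hA, hcond⟩
  exact ⟨⟨TreasureHunt.isPublicSharing_sigmaStar G, G.beliefs, hG.isPerfectBayesianWith⟩,
    fun m hm => TreasureHunt.isRiskDominant_Istar h_pos h_anti (hF m hm) (hA m hm)⟩
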